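/- **Setting.** Let $n\ge 8$, $p\in[1,2]$, $q\in[2,\infty]$ with $\frac1p+\frac1q=1$, and $\rho_n=\min\{q-1,\,16\ln n-8\}\,n^{2/q-1}$. Let $d:\mathbb R^n\to\mathbb R$ be a prox-function, i.e. differentiable with $V[z](x):=d(x)-d(z)-\langle\nabla d(z),x-z\rangle\ge\frac12\|x-z\|_p^2$ for all $x,z$. Consider $\min_{x\in\mathbb R^n} f(x)$, $f(x)=\mathbb E_\xi F(x,\xi)$, $\xi\sim P$, where $f$ is finite and convex with a minimizer $x^*$; for $P$-almost every $\xi$ the function $F(\cdot,\xi)$ has a gradient $g(\cdot,\xi)$ that is $L(\xi)$-Lipschitz in the Euclidean norm, with $0<L_2:=\sqrt{\mathbb E L(\xi)^2}<\infty$; and $\mathbb E_\xi\|g(x,\xi)-\nabla f(x)\|_2^2\le\sigma^2$ for all $x$. One oracle call at a pair $(x,y)$ draws $\xi\sim P$ and returns $(\tilde f(x,\xi),\tilde f(y,\xi))$, where $\tilde f=F+\eta$ with an arbitrary (measurable) noise $\eta$ such that, for every $x$, $|\eta(x,\xi)|\le\Delta$ almost surely. **ARDFDS** with starting point $x_0$,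 batch size $m$, smoothing parameter $t>0$ and stepsizes $\alpha_k$: put $y_0=z_0=x_0$; for $k=0,\dots,N-1$ draw $e_{k+1}$ uniformly on the unit Euclidean sphere and $\xi_1,\dots,\xi_m\sim P$, all independent of each other and of the past, and set $\tau_k=\frac2{k+2}$, $x_{k+1}=\tau_kz_k+(1-\tau_k)y_k$, $G=\frac1m\sum_{i=1}^m\frac{\tilde f(x_{k+1}+te_{k+1},\xi_i)-\tilde f(x_{k+1},\xi_i)}{t}e_{k+1}$ (which takes $m$ oracle calls), $y_{k+1}=x_{k+1}-\frac1{2L_2}G$, $z_{k+1}=\arg\min_z\{\alpha_{k+1}n\langle G,z-z_k\rangle+V[z_k](z)\}$. Let $\Theta_p=V[x_0](x^*)$ and $\alpha_{k+1}=\frac{k+2}{96n^2\rho_nL_2}$. **Corollary 1.** (a) There are absolute constants $A,B,c,K>0$ such that in this setting, for every $\varepsilon>0$ and every $x_0$, if $$N=\Big\lfloor A\sqrt{\tfrac{n^2\rho_nL_2\Theta_p}{\varepsilon}}\Big\rfloor,\quad m=\Big\lceil B\max\Big\{1,\tfrac{\sigma^2}{\varepsilon^{3/2}}\sqrt{\tfrac{\rho_n\Theta_p}{L_2}}\Big\}\Big\rceil,\quad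 0<\Delta\le c\,\min\Big\{\tfrac{\varepsilon^2}{nL_2\Theta_p},\tfrac{\varepsilon^{3/2}}{\sqrt{n^2\rho_nL_2\Theta_p}}\Big\},\quad t=2\sqrt{\tfrac{\Delta}{L_2}}$$ (no upper bound on $\Delta$ when $\Theta_p=0$), then $\mathbb E f(y_N)$ is finite and $$\mathbb E f(y_N)-f(x^*)\le\varepsilon .$$ Moreover $N\le K\sqrt{n^2\rho_nL_2\Theta_p/\varepsilon}$, $1\le m\le K\max\{1,\frac{\sigma^2}{\varepsilon^{3/2}}\sqrt{\rho_n\Theta_p/L_2}\}$, $t\le K\min\{\frac{\varepsilon}{L_2\sqrt{n\Theta_p}},\frac{\varepsilon^{3/4}}{(n^2\rho_nL_2^3\Theta_p)^{1/4}}\}$ (no bound on $t$ is claimed when $\Theta_p=0$), and the total number of oracle calls equals $$Nm\le K\max\Big\{\sqrt{\tfrac{n^2\rho_nL_2\Theta_p}{\varepsilon}},\ \tfrac{n\rho_n\sigma^2\Theta_p}{\varepsilon^2}\Big\}.$$ If in addition either $p=2$ and $d(x)=\frac12\|x\|_2^2$, or $p=1$ and $d(x)=\frac{\mathrm e\,n^{(\kappa-1)(2-\kappa)/\kappa}\ln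 n}{2}\|x-x_0\|_\kappa^2$ with $\kappa=1+\frac1{\ln n}$, then with $R_p=\|x_0-x^*\|_p$ $$Nm\le K(\ln n)^2\max\Big\{n^{\frac12+\frac1q}\sqrt{\tfrac{L_2R_p^2}{\varepsilon}},\ \tfrac{n^{2/q}\sigma^2R_p^2}{\varepsilon^2}\Big\}.$$ (b) For $n\ge8$ and every $c\in\mathbb R^n$, the function $x\mapsto\frac{\mathrm e\,n^{(\kappa-1)(2-\kappa)/\kappa}\ln n}{2}\|x-c\|_\kappa^2$ is a prox-function for $p=1$, and $\frac12\|x\|_2^2$ is one for $p=2$. -/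

import Mathlib

open MeasureTheory ProbabilityTheory

noncomputable section

namespace ARDFDS

/-- `ℝⁿ` with its Euclidean norm and inner product. -/
abbrev E (n : ℕ) : Type := EuclideanSpace ℝ (Fin n)

/-- The `p`-norm of a vector of `ℝⁿ`. -/
def pNorm {n : ℕ} (p : ENNReal) (x : E n) : ℝ :=
  ‖(WithLp.toLp p (fun i => x i) : PiLp p (fun _ : Fin n => ℝ))‖

/-- `ρ_n = min {q - 1, 16 ln n - 8} * n ^ (2 / q - 1)`, where `q ∈ [2, ∞]`. -/
def rho (n : ℕ) (q : ENNReal) : ℝ :=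
  (min (q - 1) (ENNReal.ofReal (16 * Real.log n - 8))).toReal *
    (n : ℝ) ^ (2 * (q⁻¹).toReal - 1)

/-! ### Proximal setup -/

/-- A differentiable function that is `1`-strongly convex with respect to the `p`-norm. -/
structure IsProxFunction {n : ℕ} (p : ENNReal) (d : E n → ℝ) : Prop where
  differentiable : Differentiable ℝ d
  strongly_convex : ∀ x y : E n,
    1 / 2 * pNorm p (y - x) ^ 2 ≤ d y - d x - inner ℝ (gradient d x) (y - x)

/-- Bregman divergence `V[z](x)` of `d`. -/
def bregman {n : ℕ} (d : E n → ℝ) (z x : E n) : ℝ :=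
  d x - d z - inner ℝ (gradient d z) (x - z)

/-- The Euclidean prox-function `‖x‖₂² / 2` (case `p = 2`). -/
def proxTwo (n : ℕ) (x : E n) : ℝ := 1 / 2 * ‖x‖ ^ 2

/-- The exponent `κ = 1 + 1 / ln n`. -/
def kappa (n : ℕ) : ℝ := 1 + 1 / Real.log n

/-- The prox-function `(e n ^ ((κ - 1) (2 - κ) / κ) ln n / 2) ‖x - c‖_κ²` (case `p = 1`),
centred at the point `c`. -/
def proxOne (n : ℕ) (c x : E n) : ℝ :=
  Real.exp 1 * (n : ℝ) ^ ((kappa n - 1) * (2 - kappa n) / kappa n) * Real.log n / 2 *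
    pNorm (ENNReal.ofReal (kappa n)) (x - c) ^ 2

/-! ### The stochastic optimization problem -/

/-- The objective `f(x) = E_ξ F(x, ξ)`. -/
def objective {n : ℕ} {Ξ : Type*} [MeasurableSpace Ξ] (F : E n → Ξ → ℝ) (P : Measure Ξ)
    (x : E n) : ℝ :=
  ∫ ξ, F x ξ ∂P

/-- `L₂ = √(E_ξ L(ξ)²)`. -/
def L2 {Ξ : Type*} [MeasurableSpace Ξ] (L : Ξ → ℝ) (P : Measure Ξ) : ℝ :=
  √(∫ ξ, L ξ ^ 2 ∂P)

/-- The assumptions on the problem: `f` is well defined and convex; for almost every `ξ` the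
function `F(·, ξ)` has an `L(ξ)`-Lipschitz gradient, with `E L(ξ)² < ∞`; the variance of the
stochastic gradient is at most `σ²` at every point. -/
structure IsProblem {n : ℕ} {Ξ : Type*} [MeasurableSpace Ξ] (F : E n → Ξ → ℝ) (P : Measure Ξ)
    (L : Ξ → ℝ) (σ : ℝ) : Prop where
  measurable : Measurable (Function.uncurry F)
  integrable : ∀ x, Integrable (F x) P
  convex : ConvexOn ℝ Set.univ (objective F P)
  differentiable : ∀ᵐ ξ ∂P, Differentiable ℝ (fun x => F x ξ)
  lipschitz : ∀ᵐ ξ ∂P, ∀ x y : E n,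
    ‖gradient (fun u => F u ξ) x - gradient (fun u => F u ξ) y‖ ≤ L ξ * ‖x - y‖
  memLp : MemLp L 2 P
  variance : ∀ x : E n,
    ∫⁻ ξ, ‖gradient (fun u => F u ξ) x - gradient (objective F P) x‖ₑ ^ 2 ∂P
      ≤ ENNReal.ofReal (σ ^ 2)

/-! ### The algorithm -/

/-- The uniform probability distribution on the unit Euclidean sphere of `ℝⁿ`. -/
def sphereLaw (n : ℕ) : Measure (E n) :=
  (((volume : Measure (E n)).toSphere Set.univ)⁻¹ • (volume : Measure (E n)).toSphere).map
    Subtype.val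

/-- One call of the two-point oracle: the pair of noisy values at `x` and `y` for one and the
same `ξ`, together with the number of oracle calls that it costs. -/
def oracleCall {n : ℕ} {Ξ : Type*} (ftilde : E n → Ξ → ℝ) (x y : E n) (ξ : Ξ) : (ℝ × ℝ) × ℕ :=
  ((ftilde x ξ, ftilde y ξ), 1)

/-- The mini-batch finite-difference approximation of the gradient at `x` along the direction `e`,
`m⁻¹ ∑ᵢ (f̃(x + t e, ξᵢ) - f̃(x, ξᵢ)) / t • e`, together with the number of oracle calls used. -/
def gradEst {n m : ℕ} {Ξ : Type*} (ftilde : E n → Ξ → ℝ) (t : ℝ) (x e : E n) (ξ : Fin m → Ξ) :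
    E n × ℕ :=
  let r : Fin m → (ℝ × ℝ) × ℕ := fun i => oracleCall ftilde (x + t • e) x (ξ i)
  ((1 / (m : ℝ)) • ∑ i, (((r i).1.1 - (r i).1.2) / t) • e, ∑ i, (r i).2)

/-- The mirror descent step `argmin_u {a ⟨g, u - z⟩ + V[z](u)}`. When `d` is a prox-function
the minimizer exists and is unique. -/
def mirrorStep {n : ℕ} (d : E n → ℝ) (a : ℝ) (g z : E n) : E n :=
  Classical.epsilon fun w : E n =>
    IsMinOn (fun u : E n => a * inner ℝ g (u - z) + bregman d z u) Set.univ w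

/-- State of the method: the points `y_k`, `z_k` and the number of oracle calls made so far. -/
structure State (n : ℕ) where
  y : E n
  z : E n
  calls : ℕ

/-- The state of ARDFDS after `k` iterations, for noisy values `ftilde`, prox-function `d`,
Lipschitz parameter `ℓ`, stepsizes `α`, smoothing parameter `t`, starting point `x₀`,
directions `e 0, e 1, …` and batches `ξ 0, ξ 1, …` of size `m`; iteration `k` uses `e k`
and `ξ k`. -/
def run {n m : ℕ} {Ξ : Type*} (ftilde : E n → Ξ → ℝ) (d : E n → ℝ) (ℓ : ℝ) (α : ℕ → ℝ) (t : ℝ)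
    (x₀ : E n) (e : ℕ → E n) (ξ : ℕ → Fin m → Ξ) : ℕ → State n
  | 0 => ⟨x₀, x₀, 0⟩
  | k + 1 =>
    let s := run ftilde d ℓ α t x₀ e ξ k
    let τ : ℝ := 2 / ((k : ℝ) + 2)
    let x : E n := τ • s.z + (1 - τ) • s.y
    let G := gradEst ftilde t x (e k) (ξ k)
    { y := x - (1 / (2 * ℓ)) • G.1
      z := mirrorStep d (α (k + 1) * n) G.1 s.z
      calls := s.calls + G.2 }

/-- The stepsizes `α_k = (k + 1) / (96 n² ρ L₂)`, that is `α_{k+1} = (k + 2) / (96 n² ρ L₂)`. -/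
def stepSize (n : ℕ) (ρ ℓ : ℝ) (k : ℕ) : ℝ :=
  ((k : ℝ) + 1) / (96 * (n : ℝ) ^ 2 * ρ * ℓ)

/-- The joint law of all the randomness of `N` iterations: `N` independent copies of a uniform
direction on the sphere and, independently of it, `m` independent realizations of `ξ`. -/
def sampleLaw (n N m : ℕ) {Ξ : Type*} [MeasurableSpace Ξ] (P : Measure Ξ) :
    Measure (Fin N → E n × (Fin m → Ξ)) :=
  Measure.pi fun _ => (sphereLaw n).prod (Measure.pi fun _ => P)

end ARDFDS

end

open ARDFDS

/-!
Let `e` be uniform on the sphere. A difference quotient of the noisy oracle along `e` is the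
directional derivative `⟨∇f(x), e⟩`, plus a centred term `⟨H, e⟩` with `E ‖H‖² ≤ σ² / m`, plus an
error of mean square at most `4 Δ L₂`, as `t = 2 √(Δ / L₂)` balances the Taylor remainder, of
order `L₂ t`, against the noise, of order `Δ / t`.

Since `E ⟨g, e⟩ ⟨v, e⟩ = ⟨g, v⟩ / n`, the linear term of the mirror step is unbiased up to this
error. Sign changes and swaps of coordinates preserve `‖e‖_q`, so
`E ⟨g, e⟩² ‖e‖_q² = ‖g‖² E ‖e‖_q² / n` exactly, with `E ‖e‖_q² ≤ 3 ρ_n` by the rotation invariance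
of the even moments. With the given stepsizes the quadratic term of the mirror step is therefore
paid for by the expected decrease `‖∇f(x)‖² / (4 n L₂)` of the gradient step.

The iterates need not be bounded, so the product of the error with `z_k - x*` is split by Young's
inequality with weight `1 / N`. As a result the expectation of the potential
`k (k + 2) / (2 c) * (f(y_k) - f(x*)) + V[z_k](x*)`, where `c = 96 n² ρ_n L₂`, grows per step by
at most the factor `1 + 1 / N` and a small additive term, and `(1 + 1 / N) ^ N ≤ exp 1`. If `N = 0`,
then already `f(x₀) - f(x*) ≤ L₂ V[x₀](x*) ≤ ε`.

That `proxOne` is a prox-function follows from the two-uniform convexity of the `κ`-norm, which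
reduces coordinatewise to the two-point inequality of Gross and Bonami.
-/

namespace ARDFDS

variable {n : ℕ}

section PNorm

variable {p q : ENNReal}

lemma one_le_toReal (hp : 1 ≤ p) (hp' : p ≠ ⊤) : 1 ≤ p.toReal := by
  simpa using ENNReal.toReal_mono hp' hp

lemma pNorm_eq_sum (hp : 0 < p.toReal) (x : E n) :
    pNorm p x = (∑ i, |x i| ^ p.toReal) ^ (1 / p.toReal) := by
  simp [pNorm, PiLp.norm_eq_sum hp, Real.norm_eq_abs]

lemma pNorm_one (x : E n) : pNorm 1 x = ∑ i, |x i| := by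
  simp [pNorm_eq_sum (p := 1) (by simp)]

lemma pNorm_top (x : E n) : pNorm ⊤ x = ‖(fun i => x i : Fin n → ℝ)‖ := by
  simp [pNorm]

lemma pNorm_two (x : E n) : pNorm 2 x = ‖x‖ := rfl

lemma pNorm_nonneg (hp : 1 ≤ p) (x : E n) : 0 ≤ pNorm p x :=
  have : Fact (1 ≤ p) := ⟨hp⟩
  norm_nonneg _

lemma continuous_pNorm (hp : 1 ≤ p) : Continuous (pNorm p : E n → ℝ) :=
  have : Fact (1 ≤ p) := ⟨hp⟩
  continuous_norm.comp ((PiLp.continuous_toLp p _).comp (by fun_prop))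

lemma pNorm_smul (hp : 1 ≤ p) (a : ℝ) (x : E n) : pNorm p (a • x) = |a| * pNorm p x :=
  have : Fact (1 ≤ p) := ⟨hp⟩
  norm_smul a (WithLp.toLp p (fun i => x i) : PiLp p (fun _ : Fin n => ℝ))

lemma abs_apply_le_pNorm (hp : 1 ≤ p) (x : E n) (i : Fin n) : |x i| ≤ pNorm p x :=
  have : Fact (1 ≤ p) := ⟨hp⟩
  PiLp.norm_apply_le (WithLp.toLp p (fun i => x i) : PiLp p (fun _ : Fin n => ℝ)) i

lemma pNorm_rpow (hp : 0 < p.toReal) (x : E n) :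
    pNorm p x ^ p.toReal = ∑ i, |x i| ^ p.toReal := by
  rw [pNorm_eq_sum hp, ← Real.rpow_mul (by positivity), one_div_mul_cancel hp.ne', Real.rpow_one]

lemma pNorm_anti (hp : 1 ≤ p) (hpq : p ≤ q) (x : E n) : pNorm q x ≤ pNorm p x := by
  have hM := pNorm_nonneg hp x
  rcases eq_or_ne q ⊤ with rfl | hq
  · rw [pNorm_top, pi_norm_le_iff_of_nonneg hM]
    exact abs_apply_le_pNorm hp x
  have hp' : p ≠ ⊤ := ne_top_of_le_ne_top hq hpq
  have hp0 : 0 < p.toReal := one_pos.trans_le (one_le_toReal hp hp')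
  have hle : p.toReal ≤ q.toReal := ENNReal.toReal_mono hq hpq
  have hq0 : 0 < q.toReal := hp0.trans_le hle
  have hsplit {s : ℝ} (hs : 0 ≤ s) :
      s ^ q.toReal = s ^ (q.toReal - p.toReal) * s ^ p.toReal := by
    rw [← Real.rpow_add_of_nonneg hs (sub_nonneg.2 hle) hp0.le, sub_add_cancel]
  rw [← Real.rpow_le_rpow_iff (pNorm_nonneg (hp.trans hpq) x) hM hq0, pNorm_rpow hq0, hsplit hM,
    pNorm_rpow hp0, Finset.mul_sum]
  refine Finset.sum_le_sum fun i _ => ?_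
  rw [hsplit (abs_nonneg _)]
  gcongr
  exact abs_apply_le_pNorm hp x i

lemma norm_le_pNorm (hp : 1 ≤ p) (hp2 : p ≤ 2) (x : E n) : ‖x‖ ≤ pNorm p x :=
  pNorm_anti hp hp2 x

lemma pNorm_le_rpow_mul_pNorm (hp : 1 ≤ p) (hpq : p ≤ q) (hq : q ≠ ⊤) (x : E n) :
    pNorm p x ≤ (n : ℝ) ^ (1 / p.toReal - 1 / q.toReal) * pNorm q x := by
  have hp0 : 0 < p.toReal := one_pos.trans_le (one_le_toReal hp (ne_top_of_le_ne_top hq hpq))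
  have hle : p.toReal ≤ q.toReal := ENNReal.toReal_mono hq hpq
  have hq0 : 0 < q.toReal := hp0.trans_le hle
  have hpow (i : Fin n) : (|x i| ^ p.toReal) ^ (q.toReal / p.toReal) = |x i| ^ q.toReal := by
    rw [← Real.rpow_mul (abs_nonneg _), mul_div_cancel₀ _ hp0.ne']
  have hmean := Real.rpow_sum_le_const_mul_sum_rpow_of_nonneg (Finset.univ : Finset (Fin n))
    (f := fun i => |x i| ^ p.toReal) ((one_le_div hp0).2 hle) fun i _ => by positivity
  simp only [hpow, Finset.card_univ, Fintype.card_fin] at hmean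
  rw [← pNorm_rpow hp0, ← pNorm_rpow hq0, ← Real.rpow_mul (pNorm_nonneg hp x),
    mul_div_cancel₀ _ hp0.ne'] at hmean
  have hx := pNorm_nonneg (hp.trans hpq) x
  rw [← Real.rpow_le_rpow_iff (pNorm_nonneg hp x) (by positivity) hq0,
    Real.mul_rpow (by positivity) hx, ← Real.rpow_mul n.cast_nonneg]
  convert hmean using 3
  field_simp

lemma inner_eq_sum (u v : E n) : inner ℝ u v = ∑ i, u i * v i := by
  simp [PiLp.inner_apply, mul_comm]

lemma inner_le_pNorm_top_mul_pNorm_one (u v : E n) : inner ℝ u v ≤ pNorm ⊤ u * pNorm 1 v := by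
  rw [inner_eq_sum, pNorm_one, Finset.mul_sum]
  refine Finset.sum_le_sum fun i _ => (le_abs_self _).trans ?_
  rw [abs_mul]
  gcongr
  exact abs_apply_le_pNorm le_top u i

lemma inner_le_pNorm_mul_pNorm (hpq : p⁻¹ + q⁻¹ = 1) (u v : E n) :
    inner ℝ u v ≤ pNorm q u * pNorm p v := by
  rcases eq_or_ne q ⊤ with rfl | hq
  · obtain rfl : p = 1 := by simpa using hpq
    exact inner_le_pNorm_top_mul_pNorm_one u v
  rcases eq_or_ne p ⊤ with rfl | hp
  · obtain rfl : q = 1 := by simpa using hpq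
    rw [real_inner_comm, mul_comm]
    exact inner_le_pNorm_top_mul_pNorm_one v u
  have hconj : q.toReal.HolderConjugate p.toReal := by
    have : q.HolderConjugate p := ⟨by rw [add_comm, hpq, inv_one]⟩
    exact ENNReal.HolderConjugate.toReal_of_ne_top hq hp
  have h := Real.inner_le_Lp_mul_Lq Finset.univ (fun i => u i) (fun i => v i) hconj
  rwa [← pNorm_eq_sum hconj.pos, ← pNorm_eq_sum hconj.symm.pos, ← inner_eq_sum] at h

lemma two_le_of_inv_add_inv_eq_one (hp2 : p ≤ 2) (hpq : p⁻¹ + q⁻¹ = 1) : 2 ≤ q := by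
  rw [← ENNReal.inv_le_inv]
  by_contra! h
  have : (2 : ENNReal)⁻¹ + 2⁻¹ < p⁻¹ + q⁻¹ :=
    ENNReal.add_lt_add_of_le_of_lt (by simp) (ENNReal.inv_le_inv.2 hp2) h
  rw [hpq, ENNReal.inv_two_add_inv_two] at this
  exact lt_irrefl _ this

end PNorm

section TwoPoint

variable {p t : ℝ}

lemma two_le_rpow_add_rpow {s : ℝ} (hs : s ≤ 0) (ht : -1 < t) (ht1 : t < 1) :
    2 ≤ (1 + t) ^ s + (1 - t) ^ s := by
  have h1 : 0 < (1 + t) ^ s := Real.rpow_pos_of_pos (by linarith) _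
  have h2 : 0 < (1 - t) ^ s := Real.rpow_pos_of_pos (by linarith) _
  have hmul : 1 ≤ (1 + t) ^ s * (1 - t) ^ s := by
    rw [← Real.mul_rpow (by linarith) (by linarith)]
    exact Real.one_le_rpow_of_pos_of_le_one_of_nonpos (by nlinarith)
      (by nlinarith [sq_nonneg t]) hs
  nlinarith [sq_nonneg ((1 + t) ^ s - (1 - t) ^ s)]

lemma hasDerivAt_one_add_rpow {s : ℝ} (ht : 0 < 1 + t) :
    HasDerivAt (fun t : ℝ => (1 + t) ^ s) (s * (1 + t) ^ (s - 1)) t := by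
  simpa using ((hasDerivAt_id t).const_add 1).rpow_const (p := s) (Or.inl ht.ne')

lemma hasDerivAt_one_sub_rpow {s : ℝ} (ht : 0 < 1 - t) :
    HasDerivAt (fun t : ℝ => (1 - t) ^ s) (-(s * (1 - t) ^ (s - 1))) t := by
  simpa using ((hasDerivAt_id t).const_sub 1).rpow_const (p := s) (Or.inl ht.ne')

lemma le_of_hasDerivAt_nonneg {f f' : ℝ → ℝ} (hf : ContinuousOn f (Set.Icc 0 1))
    (hd : ∀ t ∈ Set.Ioo (0 : ℝ) 1, HasDerivAt f (f' t) t)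
    (hf' : ∀ t ∈ Set.Ioo (0 : ℝ) 1, 0 ≤ f' t) (ht : t ∈ Set.Icc (0 : ℝ) 1) : f 0 ≤ f t := by
  refine monotoneOn_of_hasDerivWithinAt_nonneg (convex_Icc _ _) hf (f' := f') ?_ ?_
    (Set.left_mem_Icc.2 zero_le_one) ht ht.1
  · rw [interior_Icc]
    exact fun s hs => (hd s hs).hasDerivWithinAt
  · rwa [interior_Icc]

lemma two_mul_le_rpow_sub_rpow (hp : 1 ≤ p) (hp2 : p ≤ 2) (ht : t ∈ Set.Icc (0 : ℝ) 1) :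
    2 * (p - 1) * t ≤ (1 + t) ^ (p - 1) - (1 - t) ^ (p - 1) := by
  have hp1 : 0 ≤ p - 1 := by linarith
  have h := le_of_hasDerivAt_nonneg
    (f := fun t : ℝ => (1 + t) ^ (p - 1) - (1 - t) ^ (p - 1) - 2 * (p - 1) * t)
    (by fun_prop (disch := simp [hp1]))
    (fun t ht => ((hasDerivAt_one_add_rpow (by linarith [ht.1])).sub
      (hasDerivAt_one_sub_rpow (by linarith [ht.2]))).sub ((hasDerivAt_id t).const_mul _))
    (fun t ht => by
      nlinarith [two_le_rpow_add_rpow (s := p - 1 - 1) (by linarith)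
        (by linarith [ht.1]) ht.2]) ht
  norm_num at h
  linarith

lemma two_add_le_rpow_add_rpow (hp : 1 ≤ p) (hp2 : p ≤ 2) (ht : |t| ≤ 1) :
    2 + p * (p - 1) * t ^ 2 ≤ (1 + t) ^ p + (1 - t) ^ p := by
  wlog ht0 : 0 ≤ t generalizing t
  · have h := this (t := -t) (by rwa [abs_neg]) (by linarith)
    rwa [neg_sq, sub_neg_eq_add, ← sub_eq_add_neg, add_comm ((1 - t) ^ p)] at h
  have hp0 : 0 ≤ p := by linarith
  have h := le_of_hasDerivAt_nonneg
    (f := fun t : ℝ => (1 + t) ^ p + (1 - t) ^ p - p * (p - 1) * t ^ 2)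
    (by fun_prop (disch := simp [hp0]))
    (fun t ht => ((hasDerivAt_one_add_rpow (by linarith [ht.1])).add
      (hasDerivAt_one_sub_rpow (by linarith [ht.2]))).sub ((hasDerivAt_pow 2 t).const_mul _))
    (fun t ht => by
      have := two_mul_le_rpow_sub_rpow hp hp2 (Set.Ioo_subset_Icc_self ht)
      norm_num
      nlinarith) ⟨ht0, (abs_le.1 ht).2⟩
  norm_num at h
  linarith

lemma two_point_of_abs_le {a b : ℝ} (hp : 1 ≤ p) (hp2 : p ≤ 2) (hba : |b| ≤ |a|) :
    (a ^ 2 + (p - 1) * b ^ 2) ^ (p / 2) ≤ (|a + b| ^ p + |a - b| ^ p) / 2 := by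
  rcases eq_or_ne a 0 with rfl | ha
  · obtain rfl : b = 0 := by simpa using hba
    simp [Real.zero_rpow (by linarith : p ≠ 0), Real.zero_rpow (by linarith : p / 2 ≠ 0)]
  obtain ⟨t, rfl⟩ : ∃ t, b = a * t := ⟨b / a, by field_simp⟩
  have ht : |t| ≤ 1 := by
    rw [abs_mul] at hba
    exact (mul_le_iff_le_one_right (abs_pos.2 ha)).1 hba
  obtain ⟨ht0, ht1⟩ := abs_le.1 ht
  have hfac : a ^ 2 + (p - 1) * (a * t) ^ 2 = |a| ^ 2 * (1 + (p - 1) * t ^ 2) := by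
    rw [sq_abs]; ring
  have hadd : |a + a * t| = |a| * (1 + t) := by
    rw [← mul_one_add, abs_mul, abs_of_nonneg (by linarith : 0 ≤ 1 + t)]
  have hsub : |a - a * t| = |a| * (1 - t) := by
    rw [← mul_one_sub, abs_mul, abs_of_nonneg (by linarith : 0 ≤ 1 - t)]
  have hsq : (|a| ^ 2) ^ (p / 2) = |a| ^ p := by
    rw [← Real.rpow_two, ← Real.rpow_mul (abs_nonneg a), mul_div_cancel₀ _ two_ne_zero]
  have hp1 : 0 ≤ (p - 1) * t ^ 2 := mul_nonneg (by linarith) (sq_nonneg t)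
  rw [hfac, hadd, hsub, Real.mul_rpow (by positivity) (by linarith), hsq,
    Real.mul_rpow (abs_nonneg a) (by linarith), Real.mul_rpow (abs_nonneg a) (by linarith),
    ← mul_add, mul_div_assoc]
  gcongr
  calc (1 + (p - 1) * t ^ 2) ^ (p / 2) ≤ 1 + p / 2 * ((p - 1) * t ^ 2) :=
        rpow_one_add_le_one_add_mul_self (by linarith) (by linarith) (by linarith)
    _ ≤ ((1 + t) ^ p + (1 - t) ^ p) / 2 := by linarith [two_add_le_rpow_add_rpow hp hp2 ht]

/-- The two-point inequality of Gross and Bonami. -/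
lemma two_point (hp : 1 ≤ p) (hp2 : p ≤ 2) (a b : ℝ) :
    (a ^ 2 + (p - 1) * b ^ 2) ^ (p / 2) ≤ (|a + b| ^ p + |a - b| ^ p) / 2 := by
  rcases le_total |b| |a| with h | h
  · exact two_point_of_abs_le hp hp2 h
  refine le_trans ?_ ((two_point_of_abs_le hp hp2 h).trans_eq ?_)
  · have := mul_nonneg (sub_nonneg.2 hp) (sq_nonneg b)
    exact Real.rpow_le_rpow (by positivity) (by nlinarith [sq_le_sq.2 h]) (by linarith)
  · rw [add_comm b, abs_sub_comm b]

end TwoPoint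

section UniformConvexity

variable {p : ENNReal}

/-- The triangle inequality in the plane with the `r`-norm. -/
lemma rpow_sum_add_rpow_sum_le {ι : Type*} (s : Finset ι) (u v : ι → ℝ) {r : ℝ} (hr : 1 ≤ r)
    (hu : ∀ i, 0 ≤ u i) (hv : ∀ i, 0 ≤ v i) :
    ((∑ i ∈ s, u i) ^ r + (∑ i ∈ s, v i) ^ r) ^ (1 / r) ≤
      ∑ i ∈ s, (u i ^ r + v i ^ r) ^ (1 / r) := by
  have hr' : (ENNReal.ofReal r).toReal = r := ENNReal.toReal_ofReal (by linarith)
  have : Fact (1 ≤ ENNReal.ofReal r) := ⟨by simpa using ENNReal.ofReal_le_ofReal hr⟩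
  have hnorm {a b : ℝ} (ha : 0 ≤ a) (hb : 0 ≤ b) :
      ‖(WithLp.toLp (ENNReal.ofReal r) ![a, b] : PiLp _ fun _ : Fin 2 => ℝ)‖ =
        (a ^ r + b ^ r) ^ (1 / r) := by
    rw [PiLp.norm_eq_sum (by rw [hr']; linarith), hr']
    simp [Fin.sum_univ_two, abs_of_nonneg ha, abs_of_nonneg hb]
  have h := norm_sum_le s fun i =>
    (WithLp.toLp (ENNReal.ofReal r) ![u i, v i] : PiLp _ fun _ : Fin 2 => ℝ)
  have hsum : ∑ i ∈ s, (WithLp.toLp (ENNReal.ofReal r) ![u i, v i] : PiLp _ fun _ : Fin 2 => ℝ) =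
      WithLp.toLp _ ![∑ i ∈ s, u i, ∑ i ∈ s, v i] := by
    ext j
    fin_cases j <;> simp
  simp only [hsum, hnorm (Finset.sum_nonneg fun i _ => hu i) (Finset.sum_nonneg fun i _ => hv i),
    hnorm (hu _) (hv _)] at h
  exact h

lemma rpow_rpow_two_div {r s : ℝ} (hr : 0 < r) (hs : 0 ≤ s) : (s ^ r) ^ (2 / r) = s ^ 2 := by
  rw [← Real.rpow_mul hs, mul_div_cancel₀ _ hr.ne', Real.rpow_two]

lemma rpow_pNorm_sq_add_sq_le_sum (hp : 1 ≤ p) (hp2 : p ≤ 2) (x y : E n) :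
    (pNorm p x ^ 2 + pNorm p y ^ 2) ^ (p.toReal / 2) ≤
      ∑ i, (x i ^ 2 + y i ^ 2) ^ (p.toReal / 2) := by
  have hp0 : 0 < p.toReal :=
    one_pos.trans_le (one_le_toReal hp (ne_top_of_le_ne_top ENNReal.ofNat_ne_top hp2))
  have hr : 1 ≤ 2 / p.toReal :=
    (one_le_div hp0).2 (by simpa using ENNReal.toReal_mono ENNReal.ofNat_ne_top hp2)
  have h := rpow_sum_add_rpow_sum_le Finset.univ (fun i => |x i| ^ p.toReal)
    (fun i => |y i| ^ p.toReal) hr (fun i => by positivity) fun i => by positivity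
  simpa only [← pNorm_rpow hp0, rpow_rpow_two_div hp0, pNorm_nonneg hp, abs_nonneg, sq_abs,
    one_div_div] using h

lemma uniform_convexity_pNorm (hp : 1 ≤ p) (hp2 : p ≤ 2) (x y : E n) :
    2 * (pNorm p x ^ 2 + (p.toReal - 1) * pNorm p y ^ 2) ≤
      pNorm p (x + y) ^ 2 + pNorm p (x - y) ^ 2 := by
  have hr1 : 1 ≤ p.toReal := one_le_toReal hp (ne_top_of_le_ne_top ENNReal.ofNat_ne_top hp2)
  have hr2 : p.toReal ≤ 2 := by simpa using ENNReal.toReal_mono ENNReal.ofNat_ne_top hp2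
  have hr0 : 0 < p.toReal := by linarith
  have hp1 : 0 ≤ p.toReal - 1 := by linarith
  have hA := pNorm_nonneg hp (x + y)
  have hB := pNorm_nonneg hp (x - y)
  have hsum : (pNorm p x ^ 2 + (p.toReal - 1) * pNorm p y ^ 2) ^ (p.toReal / 2) ≤
      (pNorm p (x + y) ^ p.toReal + pNorm p (x - y) ^ p.toReal) / 2 := by
    have h := rpow_pNorm_sq_add_sq_le_sum hp hp2 x (√(p.toReal - 1) • y)
    simp only [pNorm_smul hp, mul_pow, sq_abs, Real.sq_sqrt hp1, PiLp.smul_apply,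
      smul_eq_mul] at h
    refine h.trans ?_
    rw [pNorm_rpow hr0, pNorm_rpow hr0, ← Finset.sum_add_distrib, Finset.sum_div]
    exact Finset.sum_le_sum fun i _ => two_point hr1 hr2 _ _
  have hmean : ((pNorm p (x + y) ^ p.toReal + pNorm p (x - y) ^ p.toReal) / 2) ^ (2 / p.toReal) ≤
      (pNorm p (x + y) ^ 2 + pNorm p (x - y) ^ 2) / 2 := by
    have h := (convexOn_rpow ((one_le_div hr0).2 hr2)).2 (Real.rpow_nonneg hA p.toReal)
      (Real.rpow_nonneg hB p.toReal) (by norm_num : (0 : ℝ) ≤ 1 / 2)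
      (by norm_num : (0 : ℝ) ≤ 1 / 2) (by norm_num)
    simp only [smul_eq_mul, rpow_rpow_two_div hr0 hA, rpow_rpow_two_div hr0 hB,
      ← mul_add] at h
    rwa [one_div_mul_eq_div, one_div_mul_eq_div] at h
  have hx : 0 ≤ pNorm p x ^ 2 + (p.toReal - 1) * pNorm p y ^ 2 := by positivity
  have h := (Real.rpow_le_rpow (by positivity) hsum (by positivity)).trans hmean
  rw [← Real.rpow_mul hx, div_mul_div_cancel₀' hr0.ne', div_self two_ne_zero,
    Real.rpow_one] at h
  linarith

lemma differentiable_pNorm_sq (hp : 1 < p) (hp2 : p ≤ 2) :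
    Differentiable ℝ (fun x : E n => pNorm p x ^ 2) := by
  have htop : p ≠ ⊤ := ne_top_of_le_ne_top ENNReal.ofNat_ne_top hp2
  have hr1 : 1 < p.toReal := by simpa using (ENNReal.toReal_lt_toReal ENNReal.one_ne_top htop).2 hp
  have hr2 : p.toReal ≤ 2 := by simpa using ENNReal.toReal_mono ENNReal.ofNat_ne_top hp2
  have hr0 : 0 < p.toReal := by linarith
  have hsum : Differentiable ℝ fun x : E n => ∑ i, |x i| ^ p.toReal :=
    Differentiable.fun_sum fun i _ =>
      (differentiable_norm_rpow (E := ℝ) hr1).comp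
        (by fun_prop : Differentiable ℝ fun x : E n => x i)
  have heq (x : E n) : pNorm p x ^ 2 = (∑ i, |x i| ^ p.toReal) ^ (2 / p.toReal) := by
    rw [← pNorm_rpow hr0, rpow_rpow_two_div hr0 (pNorm_nonneg hp.le x)]
  simpa only [heq] using hsum.rpow_const fun _ => Or.inr ((one_le_div hr0).2 hr2)

end UniformConvexity

section Convexity

open Filter Topology

lemma deriv_le_of_two_mul_half_le {D : ℝ → ℝ} {D' : ℝ} (hD : HasDerivAt D D' 0) (h0 : D 0 = 0)
    (hhalf : ∀ s, 2 * D (s / 2) ≤ D s) : D' ≤ D 1 := by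
  have hiter (k : ℕ) : 2 ^ k * D (1 / 2 ^ k) ≤ D 1 := by
    induction k with
    | zero => simp
    | succ k ih =>
      refine le_trans ?_ ih
      rw [pow_succ, mul_assoc, ← div_div]
      exact mul_le_mul_of_nonneg_left (hhalf _) (by positivity)
  have hu : Tendsto (fun k : ℕ => (1 : ℝ) / 2 ^ k) atTop (𝓝[≠] 0) := by
    refine tendsto_nhdsWithin_iff.2 ⟨?_, .of_forall fun k => by simp⟩
    simpa using tendsto_pow_atTop_nhds_zero_of_lt_one (r := (1 : ℝ) / 2) (by norm_num) (by norm_num)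
  refine le_of_tendsto' ((hasDerivAt_iff_tendsto_slope_zero.1 hD).comp hu) fun k => ?_
  simpa [h0] using hiter k

lemma fderiv_apply_add_le_of_midpoint {V : Type*} [NormedAddCommGroup V] [NormedSpace ℝ V]
    {Φ : V → ℝ} {x h : V} {M : ℝ} (hΦ : DifferentiableAt ℝ Φ x)
    (hmid : ∀ s : ℝ, 2 * Φ (x + (s / 2) • h) + M / 2 * s ^ 2 ≤ Φ (x + s • h) + Φ x) :
    fderiv ℝ Φ x h + M ≤ Φ (x + h) - Φ x := by
  have hline : HasDerivAt (fun s : ℝ => Φ (x + s • h)) (fderiv ℝ Φ x h) 0 := by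
    refine HasFDerivAt.comp_hasDerivAt (x := 0) (l := Φ) (f := fun s : ℝ => x + s • h) ?_ ?_
    · simpa using hΦ.hasFDerivAt
    · simpa using ((hasDerivAt_id (0 : ℝ)).smul_const h).const_add x
  have hder : HasDerivAt (fun s : ℝ => Φ (x + s • h) - Φ x - M * s ^ 2) (fderiv ℝ Φ x h) 0 :=
    ((hline.sub_const (Φ x)).sub (((hasDerivAt_id (0 : ℝ)).pow 2).const_mul M)).congr_deriv
      (by simp)
  have hle := deriv_le_of_two_mul_half_le hder (by simp) fun s => by nlinarith [hmid s]
  simp only [one_smul, one_pow, mul_one] at hle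
  linarith

lemma gradient_eq_of_isMinOn_sub_inner {V : Type*} [NormedAddCommGroup V] [InnerProductSpace ℝ V]
    [CompleteSpace V] {f : V → ℝ} {w v : V} (hf : DifferentiableAt ℝ f w)
    (hmin : ∀ u, f w - inner ℝ v w ≤ f u - inner ℝ v u) : gradient f w = v := by
  have hderiv : HasFDerivAt (fun u => f u - inner ℝ v u) (fderiv ℝ f w - innerSL ℝ v) w :=
    hf.hasFDerivAt.sub (innerSL ℝ v).hasFDerivAt
  have hzero := IsLocalMin.hasFDerivAt_eq_zero (.of_forall hmin) hderiv
  refine ext_inner_right ℝ fun u => ?_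
  simpa [inner_gradient_left, sub_eq_zero] using DFunLike.congr_fun hzero u

lemma hasGradientAt_half_norm_sq {V : Type*} [NormedAddCommGroup V] [InnerProductSpace ℝ V]
    [CompleteSpace V] (x : V) : HasGradientAt (fun u : V => 1 / 2 * ‖u‖ ^ 2) x x := by
  rw [hasGradientAt_iff_hasFDerivAt]
  have hdual : (1 / 2 : ℝ) • (2 • innerSL ℝ x) = InnerProductSpace.toDual ℝ V x := by
    ext v
    simp
  exact hdual ▸ (hasStrictFDerivAt_norm_sq x).hasFDerivAt.const_mul (1 / 2 : ℝ)

end Convexity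

section StandardProx

lemma one_lt_log (hn : 3 ≤ n) : 1 < Real.log n := by
  rw [Real.lt_log_iff_exp_lt (by positivity)]
  exact Real.exp_one_lt_three.trans_le (by exact_mod_cast hn)

lemma one_lt_kappa (hn : 3 ≤ n) : 1 < kappa n := by
  have := one_lt_log hn
  unfold kappa
  linarith [show 0 < 1 / Real.log n by positivity]

lemma kappa_le_two (hn : 3 ≤ n) : kappa n ≤ 2 := by
  have := one_div_le_one_div_of_le one_pos (one_lt_log hn).le
  unfold kappa
  linarith

lemma log_mul_kappa_sub_one (hn : 3 ≤ n) : Real.log n * (kappa n - 1) = 1 := by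
  have := one_lt_log hn
  rw [kappa, add_sub_cancel_left, mul_one_div_cancel (by positivity)]

lemma rpow_kappa_sub_one (hn : 3 ≤ n) : (n : ℝ) ^ (kappa n - 1) = Real.exp 1 := by
  rw [Real.rpow_def_of_pos (by positivity), log_mul_kappa_sub_one hn]

lemma half_pNorm_one_sq_le (hn : 3 ≤ n) (x : E n) :
    1 / 2 * pNorm 1 x ^ 2 ≤ (kappa n - 1) * proxOne n 0 x := by
  set κ := kappa n with hκ
  have hκ1 : 1 < κ := one_lt_kappa hn
  have hn0 : (0 : ℝ) < n := by positivity
  have hcompare : pNorm 1 x ≤ (n : ℝ) ^ (1 - 1 / κ) * pNorm (ENNReal.ofReal κ) x := by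
    simpa [ENNReal.toReal_ofReal (one_pos.trans hκ1).le] using
      pNorm_le_rpow_mul_pNorm le_rfl (ENNReal.one_le_ofReal.2 hκ1.le) ENNReal.ofReal_ne_top x
  have hexp : Real.exp 1 * (n : ℝ) ^ ((κ - 1) * (2 - κ) / κ) = ((n : ℝ) ^ (1 - 1 / κ)) ^ 2 := by
    rw [← rpow_kappa_sub_one hn, ← Real.rpow_add hn0, ← Real.rpow_mul_natCast hn0.le]
    congr 1
    push_cast
    field_simp
    ring
  calc 1 / 2 * pNorm 1 x ^ 2
      ≤ 1 / 2 * ((n : ℝ) ^ (1 - 1 / κ) * pNorm (ENNReal.ofReal κ) x) ^ 2 := by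
        have := pNorm_nonneg le_rfl x
        gcongr
    _ = (κ - 1) * proxOne n 0 x := by
        rw [proxOne, sub_zero, ← hκ, hexp]
        linear_combination (-1 / 2 * ((n : ℝ) ^ (1 - 1 / κ)) ^ 2 *
          pNorm (ENNReal.ofReal κ) x ^ 2) * log_mul_kappa_sub_one hn

lemma isProxFunction_proxOne (hn : 3 ≤ n) (c : E n) : IsProxFunction 1 (proxOne n c) := by
  set κ := ENNReal.ofReal (kappa n) with hκ
  set C := Real.exp 1 * (n : ℝ) ^ ((kappa n - 1) * (2 - kappa n) / kappa n) * Real.log n / 2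
  have hκ1 : 1 < κ := ENNReal.one_lt_ofReal.2 (one_lt_kappa hn)
  have hκ2 : κ ≤ 2 := ENNReal.ofReal_le_ofNat.2 (kappa_le_two hn)
  have hC : 0 ≤ C := by have := one_lt_log hn; positivity
  have hdiff : Differentiable ℝ (proxOne n c) :=
    ((differentiable_pNorm_sq hκ1 hκ2).comp (differentiable_id.sub_const c)).const_mul C
  refine ⟨hdiff, fun x y => ?_⟩
  have hconvex : fderiv ℝ (proxOne n c) x (y - x) + (kappa n - 1) * proxOne n 0 (y - x) ≤
      proxOne n c (x + (y - x)) - proxOne n c x := by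
    refine fderiv_apply_add_le_of_midpoint (hdiff x) fun s => ?_
    have hunif := uniform_convexity_pNorm hκ1.le hκ2 (x + (s / 2) • (y - x) - c)
      ((s / 2) • (y - x))
    rw [show x + (s / 2) • (y - x) - c + (s / 2) • (y - x) = x + s • (y - x) - c by module,
      show x + (s / 2) • (y - x) - c - (s / 2) • (y - x) = x - c by module, pNorm_smul hκ1.le,
      mul_pow, sq_abs, hκ, ENNReal.toReal_ofReal (one_pos.trans (one_lt_kappa hn)).le] at hunif
    have hscaled := mul_le_mul_of_nonneg_left hunif hC
    simp only [C] at hscaled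
    simp only [proxOne, sub_zero]
    linarith
  rw [add_sub_cancel] at hconvex
  rw [inner_gradient_left]
  linarith [half_pNorm_one_sq_le hn (y - x)]

lemma gradient_proxTwo (x : E n) : gradient (proxTwo n) x = x :=
  (hasGradientAt_half_norm_sq x).gradient

lemma isProxFunction_proxTwo (n : ℕ) : IsProxFunction 2 (proxTwo n) := by
  refine ⟨fun x => (hasGradientAt_half_norm_sq x).differentiableAt, fun x y => ?_⟩
  rw [gradient_proxTwo, pNorm_two, proxTwo, proxTwo, norm_sub_sq_real,
    inner_sub_right, real_inner_self_eq_norm_sq, real_inner_comm]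
  linarith

end StandardProx

section MirrorStep

variable {p : ENNReal} {d : E n → ℝ}

lemma bregman_add_bregman_sub_bregman (d : E n → ℝ) (z w u : E n) :
    bregman d z w + bregman d w u - bregman d z u =
      inner ℝ (gradient d z - gradient d w) (u - w) := by
  simp only [bregman, inner_sub_left, inner_sub_right]
  ring

lemma half_norm_sq_le_bregman (hp : 1 ≤ p) (hp2 : p ≤ 2) (hd : IsProxFunction p d) (z x : E n) :
    1 / 2 * ‖x - z‖ ^ 2 ≤ bregman d z x := by
  refine le_trans ?_ (hd.strongly_convex z x)
  gcongr
  exact norm_le_pNorm hp hp2 _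

lemma bregman_nonneg (hd : IsProxFunction p d) (z x : E n) : 0 ≤ bregman d z x :=
  le_trans (by positivity) (hd.strongly_convex z x)

lemma norm_sq_le_inner_gradient (hp : 1 ≤ p) (hp2 : p ≤ 2) (hd : IsProxFunction p d) (x y : E n) :
    ‖x - y‖ ^ 2 ≤ inner ℝ (gradient d x - gradient d y) (x - y) := by
  have hxy := half_norm_sq_le_bregman hp hp2 hd x y
  have hyx := half_norm_sq_le_bregman hp hp2 hd y x
  have hsum := bregman_add_bregman_sub_bregman d x y x
  rw [norm_sub_rev] at hxy
  simp only [bregman, sub_self, inner_zero_right] at *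
  linarith

lemma exists_gradient_eq (hp : 1 ≤ p) (hp2 : p ≤ 2) (hd : IsProxFunction p d) (v : E n) :
    ∃ w, gradient d w = v := by
  set C := ‖gradient d 0 - v‖
  have hbound (u : E n) : d 0 + ‖u‖ * (1 / 2 * ‖u‖ + -C) ≤ d u - inner ℝ v u := by
    have hgrowth := half_norm_sq_le_bregman hp hp2 hd 0 u
    have hinner := (abs_le.1 (abs_real_inner_le_norm (gradient d 0 - v) u)).1
    simp only [bregman, sub_zero, inner_sub_left] at hgrowth hinner
    linarith
  have hnorm := tendsto_norm_cocompact_atTop (E := E n)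
  have hcoercive : Filter.Tendsto (fun u => d u - inner ℝ v u) (Filter.cocompact (E n)) .atTop :=
    Filter.tendsto_atTop_mono hbound <| Filter.tendsto_atTop_add_const_left _ _ <|
      hnorm.atTop_mul_atTop₀ <| Filter.tendsto_atTop_add_const_right _ _ <|
        hnorm.const_mul_atTop (by norm_num)
  have hcont : Continuous fun u => d u - inner ℝ v u :=
    hd.differentiable.continuous.sub (by fun_prop)
  obtain ⟨w, hw⟩ := hcont.exists_forall_le hcoercive
  exact ⟨w, gradient_eq_of_isMinOn_sub_inner (hd.differentiable w) hw⟩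

/-- The inverse of the gradient map of a prox-function `d`, that is, the gradient of its convex
conjugate; mirror steps are expressed through it. For other `d`, an arbitrary point is chosen when
`v` is not a value of the gradient. -/
noncomputable def gradInv (d : E n → ℝ) (v : E n) : E n :=
  Classical.epsilon fun w => gradient d w = v

lemma gradient_gradInv (hp : 1 ≤ p) (hp2 : p ≤ 2) (hd : IsProxFunction p d) (v : E n) :
    gradient d (gradInv d v) = v :=
  Classical.epsilon_spec (exists_gradient_eq hp hp2 hd v)

lemma lipschitzWith_gradInv (hp : 1 ≤ p) (hp2 : p ≤ 2) (hd : IsProxFunction p d) :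
    LipschitzWith 1 (gradInv d) := by
  refine LipschitzWith.of_dist_le_mul fun v w => ?_
  rw [dist_eq_norm, dist_eq_norm, NNReal.coe_one, one_mul]
  have hmono := norm_sq_le_inner_gradient hp hp2 hd (gradInv d v) (gradInv d w)
  rw [gradient_gradInv hp hp2 hd, gradient_gradInv hp hp2 hd] at hmono
  nlinarith [real_inner_le_norm (v - w) (gradInv d v - gradInv d w), norm_nonneg (v - w)]

lemma mirrorStep_eq_gradInv (hp : 1 ≤ p) (hp2 : p ≤ 2) (hd : IsProxFunction p d) (a : ℝ)
    (g z : E n) : mirrorStep d a g z = gradInv d (gradient d z - a • g) := by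
  set w := gradInv d (gradient d z - a • g)
  have hw : gradient d w = gradient d z - a • g := gradient_gradInv hp hp2 hd _
  have hdiff (u : E n) : a * inner ℝ g (u - z) + bregman d z u =
      a * inner ℝ g (w - z) + bregman d z w + bregman d w u := by
    have hthree := bregman_add_bregman_sub_bregman d z w u
    rw [hw, sub_sub_cancel, real_inner_smul_left] at hthree
    simp only [inner_sub_right] at hthree ⊢
    linarith
  have hmin : IsMinOn (fun u => a * inner ℝ g (u - z) + bregman d z u) Set.univ w := fun u _ => by
    simpa [hdiff u] using bregman_nonneg hd w u
  have hle : a * inner ℝ g (mirrorStep d a g z - z) + bregman d z (mirrorStep d a g z) ≤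
      a * inner ℝ g (w - z) + bregman d z w :=
    Classical.epsilon_spec (p := IsMinOn (fun u => a * inner ℝ g (u - z) + bregman d z u) Set.univ)
      ⟨w, hmin⟩ (Set.mem_univ w)
  have hdist := half_norm_sq_le_bregman hp hp2 hd w (mirrorStep d a g z)
  have hzero : ‖mirrorStep d a g z - w‖ ^ 2 = 0 :=
    le_antisymm (by linarith [hdiff (mirrorStep d a g z)]) (sq_nonneg _)
  exact sub_eq_zero.1 (norm_eq_zero.1 (pow_eq_zero_iff two_ne_zero |>.1 hzero))

lemma gradient_mirrorStep (hp : 1 ≤ p) (hp2 : p ≤ 2) (hd : IsProxFunction p d) (a : ℝ)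
    (g z : E n) : gradient d (mirrorStep d a g z) = gradient d z - a • g := by
  rw [mirrorStep_eq_gradInv hp hp2 hd, gradient_gradInv hp hp2 hd]

lemma measurable_gradient {V : Type*} [NormedAddCommGroup V] [InnerProductSpace ℝ V]
    [CompleteSpace V] [MeasurableSpace V] [BorelSpace V] (f : V → ℝ) : Measurable (gradient f) :=
  (InnerProductSpace.toDual ℝ V).symm.continuous.measurable.comp (measurable_fderiv ℝ f)

lemma measurable_mirrorStep (hp : 1 ≤ p) (hp2 : p ≤ 2) (hd : IsProxFunction p d) (a : ℝ)
    {α : Type*} [MeasurableSpace α] {g z : α → E n} (hg : Measurable g) (hz : Measurable z) :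
    Measurable fun w => mirrorStep d a (g w) (z w) := by
  simp only [mirrorStep_eq_gradInv hp hp2 hd]
  exact (lipschitzWith_gradInv hp hp2 hd).continuous.measurable.comp
    (((measurable_gradient d).comp hz).sub (hg.const_smul a))

lemma measurable_bregman {d : E n → ℝ} (hd : Measurable d) (u : E n) :
    Measurable fun z => bregman d z u :=
  (measurable_const.sub hd).sub
    ((measurable_gradient d).inner (measurable_const.sub measurable_id))

lemma bregman_mirrorStep_le {q : ENNReal} (hp : 1 ≤ p) (hp2 : p ≤ 2) (hpq : p⁻¹ + q⁻¹ = 1)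
    (hd : IsProxFunction p d) (a : ℝ) (g z u : E n) :
    bregman d (mirrorStep d a g z) u ≤
      bregman d z u - a * inner ℝ g (z - u) + a ^ 2 / 2 * pNorm q g ^ 2 := by
  set w := mirrorStep d a g z
  have hthree := bregman_add_bregman_sub_bregman d z w u
  rw [gradient_mirrorStep hp hp2 hd, sub_sub_cancel] at hthree
  have hsplit : inner ℝ (a • g) (u - w) = a * inner ℝ g (u - z) - inner ℝ (a • g) (w - z) := by
    rw [← real_inner_smul_left, ← inner_sub_right, sub_sub_sub_cancel_right]
  have hholder : inner ℝ ((-a) • g) (w - z) ≤ |a| * pNorm q g * pNorm p (w - z) := by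
    simpa only [abs_neg, pNorm_smul (one_le_two.trans (two_le_of_inv_add_inv_eq_one hp2 hpq))] using
      inner_le_pNorm_mul_pNorm hpq ((-a) • g) (w - z)
  rw [neg_smul, inner_neg_left] at hholder
  have hyoung := two_mul_le_add_sq (|a| * pNorm q g) (pNorm p (w - z))
  rw [mul_pow, sq_abs] at hyoung
  have hstrong : 1 / 2 * pNorm p (w - z) ^ 2 ≤ bregman d z w := hd.strongly_convex z w
  rw [← neg_sub u z, inner_neg_right]
  linarith

end MirrorStep

section SphereLaw

instance isProbabilityMeasure_sphereLaw [NeZero n] : IsProbabilityMeasure (sphereLaw n) := by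
  constructor
  rw [sphereLaw, Measure.map_apply measurable_subtype_coe .univ, Set.preimage_univ,
    Measure.smul_apply, smul_eq_mul]
  refine ENNReal.inv_mul_cancel ?_ (measure_ne_top _ _)
  rw [Ne, Measure.measure_univ_eq_zero]
  exact Measure.toSphere_ne_zero _

lemma ae_norm_eq_one (n : ℕ) : ∀ᵐ e ∂sphereLaw n, ‖e‖ = 1 := by
  rw [sphereLaw, ae_map_iff measurable_subtype_coe.aemeasurable
    (measurableSet_eq_fun measurable_norm measurable_const)]
  exact .of_forall fun x => norm_eq_of_mem_sphere x

lemma ae_sum_sq_eq_one (n : ℕ) : ∀ᵐ e ∂sphereLaw n, ∑ i, e i ^ 2 = 1 := by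
  filter_upwards [ae_norm_eq_one n] with e he
  rw [← EuclideanSpace.real_norm_sq_eq, he, one_pow]

open scoped Pointwise in
lemma map_sphereLaw (U : E n ≃ₗᵢ[ℝ] E n) : (sphereLaw n).map U = sphereLaw n := by
  ext A hA
  have hU : Measurable U := U.continuous.measurable
  simp only [sphereLaw, Measure.map_apply, hU, hU hA, hA, measurable_subtype_coe,
    Measure.smul_apply, Measure.toSphere_apply' _ (measurable_subtype_coe (hU hA)),
    Measure.toSphere_apply' _ (measurable_subtype_coe hA), Subtype.image_preimage_coe]
  have hcone : Set.Ioo (0 : ℝ) 1 • (Metric.sphere (0 : E n) 1 ∩ U ⁻¹' A) =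
      U ⁻¹' (Set.Ioo (0 : ℝ) 1 • (Metric.sphere 0 1 ∩ A)) := by
    ext x
    simp only [Set.mem_smul, Set.mem_preimage, Set.mem_inter_iff, mem_sphere_zero_iff_norm]
    constructor
    · rintro ⟨r, hr, y, ⟨hy, hyA⟩, rfl⟩
      exact ⟨r, hr, U y, ⟨by rwa [U.norm_map], hyA⟩, (map_smul U r y).symm⟩
    · rintro ⟨r, hr, y, ⟨hy, hyA⟩, hxy⟩
      exact ⟨r, hr, U.symm y, ⟨by rwa [U.symm.norm_map], by simpa using hyA⟩,
        U.injective (by simpa using hxy)⟩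
  rw [hcone, U.measurePreserving.measure_preimage_emb U.toHomeomorph.measurableEmbedding]

lemma integral_sphereLaw_comp (U : E n ≃ₗᵢ[ℝ] E n) (h : E n → ℝ) :
    ∫ e, h (U e) ∂sphereLaw n = ∫ e, h e ∂sphereLaw n := by
  conv_rhs => rw [← map_sphereLaw U]
  exact (U.toHomeomorph.measurableEmbedding.integral_map h).symm

lemma integrable_sphereLaw [NeZero n] {h : E n → ℝ} (hh : Continuous h) :
    Integrable h (sphereLaw n) := by
  obtain ⟨C, hC⟩ := (isCompact_sphere (0 : E n) 1).exists_bound_of_continuousOn hh.continuousOn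
  refine Integrable.of_bound hh.aestronglyMeasurable C ?_
  filter_upwards [ae_norm_eq_one n] with e he
  exact hC e (by simpa using he)

end SphereLaw

section Isotropy

/-- The isometry that changes the sign of the `i`-th coordinate, used to see that mixed second
moments of a uniform direction vanish. -/
noncomputable def signFlip (i : Fin n) : E n ≃ₗᵢ[ℝ] E n :=
  LinearIsometryEquiv.piLpCongrRight 2
    (fun j => if j = i then LinearIsometryEquiv.neg ℝ else LinearIsometryEquiv.refl ℝ ℝ)

/-- The isometry that swaps the `i`-th and `j`-th coordinates, used to see that the coordinates of
a uniform direction are exchangeable. -/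
noncomputable def swapIso (i j : Fin n) : E n ≃ₗᵢ[ℝ] E n :=
  LinearIsometryEquiv.piLpCongrLeft 2 ℝ ℝ (Equiv.swap i j)

lemma signFlip_apply (i j : Fin n) (x : E n) : signFlip i x j = if j = i then -x j else x j := by
  simp only [signFlip, LinearIsometryEquiv.piLpCongrRight_apply]
  split_ifs <;> simp

lemma swapIso_apply (i j k : Fin n) (x : E n) : swapIso i j x k = x (Equiv.swap i j k) := by
  simp [swapIso, LinearIsometryEquiv.piLpCongrLeft_apply, Equiv.piCongrLeft'_apply]

lemma pNorm_signFlip {p : ENNReal} (hp : 1 ≤ p) (i : Fin n) (x : E n) :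
    pNorm p (signFlip i x) = pNorm p x := by
  have habs (j : Fin n) : |signFlip i x j| = |x j| := by
    rw [signFlip_apply, apply_ite abs, abs_neg, ite_self]
  rcases eq_or_ne p ⊤ with rfl | hp'
  · simp only [pNorm, PiLp.norm_eq_ciSup, Real.norm_eq_abs, habs]
  · simp only [pNorm_eq_sum (one_pos.trans_le (one_le_toReal hp hp')), habs]

lemma pNorm_swapIso {p : ENNReal} (hp : 1 ≤ p) (i j : Fin n) (x : E n) :
    pNorm p (swapIso i j x) = pNorm p x := by
  rcases eq_or_ne p ⊤ with rfl | hp'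
  · simp only [pNorm, PiLp.norm_eq_ciSup, swapIso_apply]
    exact Equiv.iSup_comp (g := fun k => ‖x k‖) (Equiv.swap i j)
  · simp only [pNorm_eq_sum (one_pos.trans_le (one_le_toReal hp hp')), swapIso_apply,
      Equiv.sum_comp (Equiv.swap i j) (fun k => |x k| ^ p.toReal)]

variable {w : E n → ℝ}

lemma integral_apply_mul_apply_mul_of_ne (hsign : ∀ i x, w (signFlip i x) = w x) {i j : Fin n}
    (hij : i ≠ j) : ∫ e, e i * e j * w e ∂sphereLaw n = 0 := by
  have hflip := integral_sphereLaw_comp (signFlip i) (fun e => e i * e j * w e)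
  simp only [signFlip_apply, hsign, if_true, if_neg hij.symm, neg_mul, integral_neg] at hflip
  linarith

lemma integral_apply_mul_self_mul [NeZero n] (hw : Continuous w)
    (hswap : ∀ i j x, w (swapIso i j x) = w x) (i : Fin n) :
    ∫ e, e i * e i * w e ∂sphereLaw n = (∫ e, w e ∂sphereLaw n) / n := by
  have hsame (j : Fin n) :
      ∫ e, e j * e j * w e ∂sphereLaw n = ∫ e, e i * e i * w e ∂sphereLaw n := by
    have hcomp := integral_sphereLaw_comp (swapIso j i) (fun e => e j * e j * w e)
    simpa only [swapIso_apply, hswap, Equiv.swap_apply_left] using hcomp.symm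
  have hsum : ∑ j, ∫ e, e j * e j * w e ∂sphereLaw n = ∫ e, w e ∂sphereLaw n := by
    rw [← integral_finsetSum _ fun j _ => integrable_sphereLaw (by fun_prop)]
    refine integral_congr_ae ?_
    filter_upwards [ae_sum_sq_eq_one n] with e he
    simp only [← sq, ← Finset.sum_mul, he, one_mul]
  rw [← hsum, Finset.sum_congr rfl fun j _ => hsame j, Finset.sum_const, Finset.card_univ,
    Fintype.card_fin, nsmul_eq_mul, mul_div_cancel_left₀ _ (NeZero.ne _)]

lemma integral_inner_mul_inner_mul [NeZero n] (hw : Continuous w)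
    (hsign : ∀ i x, w (signFlip i x) = w x) (hswap : ∀ i j x, w (swapIso i j x) = w x)
    (u v : E n) :
    ∫ e, inner ℝ u e * inner ℝ v e * w e ∂sphereLaw n =
      inner ℝ u v / n * ∫ e, w e ∂sphereLaw n := by
  have hint (i j : Fin n) : Integrable (fun e => u i * v j * (e i * e j * w e)) (sphereLaw n) :=
    integrable_sphereLaw (by fun_prop)
  have hentry (i j : Fin n) : ∫ e, u i * v j * (e i * e j * w e) ∂sphereLaw n =
      if i = j then u i * v i * ((∫ e, w e ∂sphereLaw n) / n) else 0 := by
    rw [integral_const_mul]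
    split_ifs with hij
    · rw [← hij, integral_apply_mul_self_mul hw hswap]
    · rw [integral_apply_mul_apply_mul_of_ne hsign hij, mul_zero]
  calc ∫ e, inner ℝ u e * inner ℝ v e * w e ∂sphereLaw n
      = ∫ e, ∑ i, ∑ j, u i * v j * (e i * e j * w e) ∂sphereLaw n := by
        congr 1 with e
        rw [inner_eq_sum, inner_eq_sum, Finset.sum_mul_sum]
        simp only [Finset.sum_mul]
        exact Finset.sum_congr rfl fun i _ => Finset.sum_congr rfl fun j _ => by ring
    _ = ∑ i, u i * v i * ((∫ e, w e ∂sphereLaw n) / n) := by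
        rw [integral_finsetSum _ fun i _ => integrable_finsetSum _ fun j _ => hint i j]
        refine Finset.sum_congr rfl fun i _ => ?_
        simp [integral_finsetSum _ fun j _ => hint i j, hentry]
    _ = inner ℝ u v / n * ∫ e, w e ∂sphereLaw n := by
        rw [← Finset.sum_mul, ← inner_eq_sum]
        ring

lemma integral_inner_mul_inner [NeZero n] (u v : E n) :
    ∫ e, inner ℝ u e * inner ℝ v e ∂sphereLaw n = inner ℝ u v / n := by
  simpa using integral_inner_mul_inner_mul (w := fun _ => 1) continuous_const
    (fun _ _ => rfl) (fun _ _ _ => rfl) u v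

lemma integral_inner_mul_inner_mul_pNorm_sq [NeZero n] {q : ENNReal} (hq : 1 ≤ q) (u v : E n) :
    ∫ e, inner ℝ u e * inner ℝ v e * pNorm q e ^ 2 ∂sphereLaw n =
      inner ℝ u v / n * ∫ e, pNorm q e ^ 2 ∂sphereLaw n :=
  integral_inner_mul_inner_mul (w := fun e => pNorm q e ^ 2) ((continuous_pNorm hq).pow 2)
    (fun i x => by rw [pNorm_signFlip hq]) (fun i j x => by rw [pNorm_swapIso hq]) u v

end Isotropy

section EvenMoments

lemma integral_comp_inner_eq {u v : E n} (huv : ‖u‖ = ‖v‖) (φ : ℝ → ℝ) :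
    ∫ e, φ (inner ℝ u e) ∂sphereLaw n = ∫ e, φ (inner ℝ v e) ∂sphereLaw n := by
  let U : E n ≃ₗᵢ[ℝ] E n := (Submodule.span ℝ {u - v})ᗮ.reflection
  have hU : U u = v := Submodule.reflection_sub huv
  rw [← integral_sphereLaw_comp U fun e => φ (inner ℝ v e)]
  simp only [← hU, LinearIsometryEquiv.inner_map_map]

lemma integral_add_mul_pow {i j : Fin n} (hij : i ≠ j) (k : ℕ) (s : ℝ) :
    ∫ e, (e i + s * e j) ^ (2 * k) ∂sphereLaw n =
      (1 + s ^ 2) ^ k * ∫ e, e i ^ (2 * k) ∂sphereLaw n := by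
  set u : E n := EuclideanSpace.single i 1 + s • EuclideanSpace.single j 1
  set v : E n := √(1 + s ^ 2) • EuclideanSpace.single i 1
  have hu : ‖u‖ ^ 2 = 1 + s ^ 2 := by
    simp [u, norm_add_sq_real, norm_smul, EuclideanSpace.inner_single_left, hij]
  have hv : ‖v‖ ^ 2 = 1 + s ^ 2 := by
    simp [v, norm_smul, Real.sq_sqrt (by positivity : (0 : ℝ) ≤ 1 + s ^ 2)]
  have huv : ‖u‖ = ‖v‖ := by rw [← sq_eq_sq₀ (norm_nonneg _) (norm_nonneg _), hu, hv]
  have hinner := integral_comp_inner_eq huv (· ^ (2 * k))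
  simp only [u, v, inner_add_left, real_inner_smul_left, EuclideanSpace.inner_single_left, map_one,
    one_mul, mul_pow, integral_const_mul] at hinner
  rw [hinner, pow_mul, Real.sq_sqrt (by positivity)]

lemma coeff_two_eq_of_forall_sum_eq {a : ℕ → ℝ} {c : ℝ} {K k : ℕ} (hK : 2 ≤ K)
    (h : ∀ s : ℝ, ∑ m ∈ Finset.range (K + 1), a m * s ^ m = (1 + s ^ 2) ^ k * c) :
    a 2 = k * c := by
  let P : Polynomial ℝ := ∑ m ∈ Finset.range (K + 1), .C (a m) * .X ^ m
  let Q : Polynomial ℝ := .expand ℝ 2 ((1 + .X) ^ k) * .C c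
  have hPQ : P = Q := Polynomial.funext fun s => by simp [P, Q, Polynomial.eval_finsetSum, h]
  have hP : P.coeff 2 = a 2 := by
    simp [P, Polynomial.finsetSum_coeff, Polynomial.coeff_X_pow, Nat.lt_succ_of_le hK]
  have hQ : Q.coeff 2 = k * c := by
    rw [Polynomial.coeff_mul_C, Polynomial.coeff_expand two_pos]
    simp [Polynomial.coeff_one_add_X_pow]
  rw [← hP, hPQ, hQ]

-- Rotation invariance makes `∫ (e i + s * e j) ^ (2 * (k + 1))` a multiple of `(1 + s²) ^ (k + 1)`;
-- the identity compares the coefficients of `s²`.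
lemma integral_pow_eq_mul [NeZero n] {i j : Fin n} (hij : i ≠ j) (k : ℕ) :
    ∫ e, e i ^ (2 * (k + 1)) ∂sphereLaw n =
      (2 * k + 1) * ∫ e, e i ^ (2 * k) * e j ^ 2 ∂sphereLaw n := by
  set K := 2 * (k + 1) with hK
  let M : ℕ → ℝ := fun m => ∫ e, e j ^ m * e i ^ (K - m) ∂sphereLaw n
  have hbinom (s : ℝ) : ∑ m ∈ Finset.range (K + 1), K.choose m * M m * s ^ m =
      (1 + s ^ 2) ^ (k + 1) * ∫ e, e i ^ K ∂sphereLaw n := by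
    rw [← integral_add_mul_pow hij, ← hK]
    simp only [add_comm (_ : ℝ) (s * _), add_pow, mul_pow]
    rw [integral_finsetSum _ fun m _ => integrable_sphereLaw (by fun_prop)]
    refine Finset.sum_congr rfl fun m _ => ?_
    simp only [M, ← integral_const_mul, ← integral_mul_const]
    congr 1 with e
    ring
  have hcoeff : K.choose 2 * M 2 = ((k + 1 : ℕ) : ℝ) * ∫ e, e i ^ K ∂sphereLaw n :=
    coeff_two_eq_of_forall_sum_eq (by omega) hbinom
  have hM : M 2 = ∫ e, e i ^ (2 * k) * e j ^ 2 ∂sphereLaw n := by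
    simp only [M, show K - 2 = 2 * k by omega, mul_comm]
  rw [Nat.cast_choose_two, hM, hK] at hcoeff
  push_cast at hcoeff
  refine mul_left_cancel₀ (by positivity : (k + 1 : ℝ) ≠ 0) ?_
  linarith

lemma integral_pow_nonneg (i : Fin n) (k : ℕ) : 0 ≤ ∫ e, e i ^ (2 * k) ∂sphereLaw n :=
  integral_nonneg fun e => (even_two_mul k).pow_nonneg (e i)

lemma mul_integral_pow_le [NeZero n] (i : Fin n) (k : ℕ) :
    n * ∫ e, e i ^ (2 * (k + 1)) ∂sphereLaw n ≤ (2 * k + 1) * ∫ e, e i ^ (2 * k) ∂sphereLaw n := by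
  have hsum : ∑ j, ∫ e, e i ^ (2 * k) * e j ^ 2 ∂sphereLaw n = ∫ e, e i ^ (2 * k) ∂sphereLaw n := by
    rw [← integral_finsetSum _ fun j _ => integrable_sphereLaw (by fun_prop)]
    refine integral_congr_ae ?_
    filter_upwards [ae_sum_sq_eq_one n] with e he
    rw [← Finset.mul_sum, he, mul_one]
  have hle (j : Fin n) : ∫ e, e i ^ (2 * (k + 1)) ∂sphereLaw n ≤
      (2 * k + 1) * ∫ e, e i ^ (2 * k) * e j ^ 2 ∂sphereLaw n := by
    rcases eq_or_ne i j with rfl | hij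
    · simp only [← pow_add, ← mul_add_one]
      exact le_mul_of_one_le_left (integral_pow_nonneg i (k + 1))
        (by linarith [k.cast_nonneg (α := ℝ)])
    · exact (integral_pow_eq_mul hij k).le
  rw [← hsum, Finset.mul_sum]
  simpa using Finset.sum_le_sum fun j (_ : j ∈ Finset.univ) => hle j

lemma integral_pow_le [NeZero n] (i : Fin n) {k K : ℕ} (hk : k ≤ K) :
    ∫ e, e i ^ (2 * k) ∂sphereLaw n ≤ ((2 * K - 1) / n : ℝ) ^ k := by
  induction k with
  | zero => simp
  | succ k ih =>
    have hK : (k : ℝ) + 1 ≤ K := by exact_mod_cast hk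
    have hn : (0 : ℝ) < n := by exact_mod_cast Nat.pos_of_neZero n
    rw [pow_succ, ← mul_div_assoc, le_div_iff₀' hn, mul_comm _ (2 * (K : ℝ) - 1)]
    exact (mul_integral_pow_le i k).trans <|
      mul_le_mul (by linarith) (ih (by omega)) (integral_pow_nonneg i k)
        (by linarith [k.cast_nonneg (α := ℝ)])

end EvenMoments

section DualNormMoment

variable {q : ENNReal}

lemma pNorm_sq_pow_eq_sum {k : ℕ} (hk : 0 < k) (x : E n) :
    (pNorm ((2 * k : ℕ) : ENNReal) x ^ 2) ^ k = ∑ i, x i ^ (2 * k) := by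
  have hrpow := pNorm_rpow (p := ((2 * k : ℕ) : ENNReal)) (by simpa using hk) x
  simp only [ENNReal.toReal_natCast, Real.rpow_natCast, (even_two_mul k).pow_abs] at hrpow
  rw [← pow_mul, hrpow]

lemma integral_pNorm_even_sq_le [NeZero n] {k : ℕ} (hk : 0 < k) :
    ∫ e, pNorm ((2 * k : ℕ) : ENNReal) e ^ 2 ∂sphereLaw n ≤
      (n : ℝ) ^ (1 / (k : ℝ)) * ((2 * k - 1) / n) := by
  have hk1 : (1 : ℝ) ≤ k := by exact_mod_cast hk
  have hcont := (continuous_pNorm (n := n) (p := (2 * k : ℕ)) (by exact_mod_cast (by omega))).pow 2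
  have hpos : 0 ≤ (2 * k - 1) / (n : ℝ) := div_nonneg (by linarith) n.cast_nonneg
  refine le_of_pow_le_pow_left₀ hk.ne' (by positivity) ?_
  calc (∫ e, pNorm ((2 * k : ℕ) : ENNReal) e ^ 2 ∂sphereLaw n) ^ k
      ≤ ∫ e, (pNorm ((2 * k : ℕ) : ENNReal) e ^ 2) ^ k ∂sphereLaw n :=
        (convexOn_pow k).map_integral_le (by fun_prop) isClosed_Ici
          (.of_forall fun e => Set.mem_Ici.2 (sq_nonneg _)) (integrable_sphereLaw hcont)
          (integrable_sphereLaw ((continuous_pow k).comp hcont))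
    _ = ∑ i, ∫ e, e i ^ (2 * k) ∂sphereLaw n := by
        simp only [pNorm_sq_pow_eq_sum hk]
        exact integral_finsetSum _ fun i _ => integrable_sphereLaw (by fun_prop)
    _ ≤ n * ((2 * k - 1) / n : ℝ) ^ k := by
        simpa using Finset.sum_le_sum fun i (_ : i ∈ Finset.univ) => integral_pow_le i (le_refl k)
    _ = ((n : ℝ) ^ (1 / (k : ℝ)) * ((2 * k - 1) / n)) ^ k := by
        rw [mul_pow, ← Real.rpow_mul_natCast n.cast_nonneg, one_div_mul_cancel (by positivity),
          Real.rpow_one]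

-- The `q`-norm is compared with the `2 ⌈q / 2⌉`-norm, whose moments are polynomial.
lemma integral_pNorm_sq_le_of_ne_top [NeZero n] (hq : 2 ≤ q) (hq' : q ≠ ⊤) :
    ∫ e, pNorm q e ^ 2 ∂sphereLaw n ≤
      3 * ((q.toReal - 1) * (n : ℝ) ^ (2 * (q⁻¹).toReal - 1)) := by
  have hn : (0 : ℝ) < n := by exact_mod_cast Nat.pos_of_neZero n
  have hq1 : 1 ≤ q := one_le_two.trans hq
  have hr2 : 2 ≤ q.toReal := by simpa using ENNReal.toReal_mono hq' hq
  set r := q.toReal with hr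
  set k := ⌈r / 2⌉₊
  have hk0 : 0 < k := Nat.ceil_pos.2 (by linarith)
  have hk_lt : (k : ℝ) < r / 2 + 1 := Nat.ceil_lt_add_one (by linarith)
  have hle : q ≤ ((2 * k : ℕ) : ENNReal) := by
    rw [← ENNReal.toReal_le_toReal hq' (ENNReal.natCast_ne_top _), ENNReal.toReal_natCast]
    push_cast
    linarith [Nat.le_ceil (r / 2)]
  have hpointwise (e : E n) : pNorm q e ^ 2 ≤
      (n : ℝ) ^ (2 / r - 1 / k) * pNorm ((2 * k : ℕ) : ENNReal) e ^ 2 := by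
    refine (pow_le_pow_left₀ (pNorm_nonneg hq1 e)
      (pNorm_le_rpow_mul_pNorm hq1 hle (ENNReal.natCast_ne_top _) e) 2).trans_eq ?_
    rw [mul_pow, ← Real.rpow_mul_natCast hn.le, ENNReal.toReal_natCast, ← hr]
    congr 2
    push_cast
    field_simp
  calc ∫ e, pNorm q e ^ 2 ∂sphereLaw n
      ≤ (n : ℝ) ^ (2 / r - 1 / k) * ∫ e, pNorm ((2 * k : ℕ) : ENNReal) e ^ 2 ∂sphereLaw n := by
        rw [← integral_const_mul]
        exact integral_mono (integrable_sphereLaw ((continuous_pNorm hq1).pow 2))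
          ((integrable_sphereLaw ((continuous_pNorm (hq1.trans hle)).pow 2)).const_mul _) hpointwise
    _ ≤ (n : ℝ) ^ (2 / r - 1 / k) * ((n : ℝ) ^ (1 / (k : ℝ)) * ((2 * k - 1) / n)) := by
        gcongr
        exact integral_pNorm_even_sq_le hk0
    _ = (2 * k - 1) * (n : ℝ) ^ (2 * (q⁻¹).toReal - 1) := by
        rw [← mul_assoc, ← Real.rpow_add hn, sub_add_cancel, Real.rpow_sub hn, Real.rpow_one,
          ENNReal.toReal_inv, ← hr, div_eq_mul_inv 2 r]
        ring
    _ ≤ 3 * (r - 1) * (n : ℝ) ^ (2 * (q⁻¹).toReal - 1) := by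
        gcongr
        linarith
    _ = 3 * ((r - 1) * (n : ℝ) ^ (2 * (q⁻¹).toReal - 1)) := mul_assoc _ _ _

lemma one_div_le_rpow_two_mul_sub_one [NeZero n] {s : ℝ} (hs : 0 ≤ s) :
    1 / (n : ℝ) ≤ (n : ℝ) ^ (2 * s - 1) := by
  rw [one_div, ← Real.rpow_neg_one]
  exact Real.rpow_le_rpow_of_exponent_le (by exact_mod_cast Nat.pos_of_neZero n) (by linarith)

-- Beyond `q = 2 ⌈ln n⌉` the `q`-norms are comparable to the maximum norm, as `n ^ (1 / ln n) = e`.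
lemma integral_pNorm_sq_le_of_log_le (hn : 3 ≤ n)
    (hq : ENNReal.ofReal (16 * Real.log n - 8) ≤ q - 1) :
    ∫ e, pNorm q e ^ 2 ∂sphereLaw n ≤
      3 * ((16 * Real.log n - 8) * (n : ℝ) ^ (2 * (q⁻¹).toReal - 1)) := by
  have : NeZero n := ⟨by omega⟩
  have hn0 : (0 : ℝ) < n := by positivity
  have hlog := one_lt_log hn
  set k := ⌈Real.log n⌉₊
  have hk_ge : Real.log n ≤ k := Nat.le_ceil _
  have hk_lt : (k : ℝ) < Real.log n + 1 := Nat.ceil_lt_add_one (by linarith)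
  have hk0 : 0 < k := Nat.ceil_pos.2 (by linarith)
  have h1k : (1 : ENNReal) ≤ ((2 * k : ℕ) : ENNReal) := by exact_mod_cast (by omega : 1 ≤ 2 * k)
  have hle : ((2 * k : ℕ) : ENNReal) ≤ q := by
    refine le_trans ?_ (hq.trans tsub_le_self)
    rw [← ENNReal.ofReal_natCast]
    apply ENNReal.ofReal_le_ofReal
    push_cast
    linarith
  have hroot : (n : ℝ) ^ (1 / (k : ℝ)) ≤ 3 := by
    rw [Real.rpow_def_of_pos hn0, mul_one_div]
    exact (Real.exp_le_exp.2 (div_le_one_of_le₀ hk_ge k.cast_nonneg)).trans Real.exp_one_lt_three.le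
  calc ∫ e, pNorm q e ^ 2 ∂sphereLaw n
      ≤ ∫ e, pNorm ((2 * k : ℕ) : ENNReal) e ^ 2 ∂sphereLaw n :=
        integral_mono (integrable_sphereLaw ((continuous_pNorm (h1k.trans hle)).pow 2))
          (integrable_sphereLaw ((continuous_pNorm h1k).pow 2))
          fun e => pow_le_pow_left₀ (pNorm_nonneg (h1k.trans hle) e) (pNorm_anti h1k hle e) 2
    _ ≤ (n : ℝ) ^ (1 / (k : ℝ)) * ((2 * k - 1) / n) := integral_pNorm_even_sq_le hk0
    _ ≤ 3 * ((2 * k - 1) / n) := by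
        gcongr
        exact div_nonneg (by linarith) hn0.le
    _ = 3 * ((2 * k - 1) * (1 / n)) := by ring
    _ ≤ 3 * ((16 * Real.log n - 8) * (n : ℝ) ^ (2 * (q⁻¹).toReal - 1)) := by
        refine mul_le_mul_of_nonneg_left (mul_le_mul (by linarith)
          (one_div_le_rpow_two_mul_sub_one ENNReal.toReal_nonneg) (by positivity) ?_) three_pos.le
        linarith

lemma integral_pNorm_sq_le_three_mul_rho (hn : 3 ≤ n) (hq : 2 ≤ q) :
    ∫ e, pNorm q e ^ 2 ∂sphereLaw n ≤ 3 * rho n q := by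
  have : NeZero n := ⟨by omega⟩
  rw [rho]
  rcases le_total (q - 1) (ENNReal.ofReal (16 * Real.log n - 8)) with h | h
  · have hq' : q ≠ ⊤ := by
      rintro rfl
      simp at h
    rw [min_eq_left h, ENNReal.toReal_sub_of_le (one_le_two.trans hq) hq', ENNReal.toReal_one]
    exact integral_pNorm_sq_le_of_ne_top hq hq'
  · rw [min_eq_right h, ENNReal.toReal_ofReal (by linarith [one_lt_log hn])]
    exact integral_pNorm_sq_le_of_log_le hn h

lemma one_le_mul_rho (hn : 3 ≤ n) (hq : 2 ≤ q) : 1 ≤ (n : ℝ) * rho n q := by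
  have : NeZero n := ⟨by omega⟩
  have hfactor : 1 ≤ (min (q - 1) (ENNReal.ofReal (16 * Real.log n - 8))).toReal := by
    rw [← ENNReal.toReal_one]
    refine ENNReal.toReal_mono (ne_top_of_le_ne_top ENNReal.ofReal_ne_top (min_le_right _ _))
      (le_min ?_ (ENNReal.one_le_ofReal.2 (by linarith [one_lt_log hn])))
    exact ENNReal.le_sub_of_add_le_left ENNReal.one_ne_top (one_add_one_eq_two.trans_le hq)
  rw [← div_le_iff₀' (by positivity)]
  exact (one_div_le_rpow_two_mul_sub_one ENNReal.toReal_nonneg).trans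
    (le_mul_of_one_le_left (by positivity) hfactor)

lemma rho_pos (hn : 3 ≤ n) (hq : 2 ≤ q) : 0 < rho n q :=
  pos_of_mul_pos_right (one_pos.trans_le (one_le_mul_rho hn hq)) n.cast_nonneg

end DualNormMoment

section LipschitzGradient

variable {V : Type*} [NormedAddCommGroup V] [InnerProductSpace ℝ V] [CompleteSpace V]

lemma hasDerivAt_comp_add_smul {f : V → ℝ} (hf : Differentiable ℝ f) (x h : V) (s : ℝ) :
    HasDerivAt (fun s : ℝ => f (x + s • h)) (inner ℝ (gradient f (x + s • h)) h) s := by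
  rw [inner_gradient_left]
  refine (hf (x + s • h)).hasFDerivAt.comp_hasDerivAt s ?_
  simpa using ((hasDerivAt_id s).smul_const h).const_add x

lemma sub_sub_inner_gradient_le {f : V → ℝ} {K : ℝ} (hf : Differentiable ℝ f)
    (hL : ∀ x y, ‖gradient f x - gradient f y‖ ≤ K * ‖x - y‖) (x y : V) :
    f y - f x - inner ℝ (gradient f x) (y - x) ≤ K / 2 * ‖y - x‖ ^ 2 := by
  set h := y - x with hh
  let φ : ℝ → ℝ := fun s => f (x + s • h) - s * inner ℝ (gradient f x) h - K / 2 * ‖h‖ ^ 2 * s ^ 2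
  have hφ (s : ℝ) : HasDerivAt φ (inner ℝ (gradient f (x + s • h) - gradient f x) h -
      K * ‖h‖ ^ 2 * s) s := by
    rw [inner_sub_left]
    refine (((hasDerivAt_comp_add_smul hf x h s).sub (hasDerivAt_mul_const _)).sub
      ((hasDerivAt_pow 2 s).const_mul (K / 2 * ‖h‖ ^ 2))).congr_deriv ?_
    norm_num
    ring
  have hanti : AntitoneOn φ (Set.Icc 0 1) := by
    refine antitoneOn_of_deriv_nonpos (convex_Icc _ _)
      (fun s _ => (hφ s).continuousAt.continuousWithinAt)
      (fun s _ => (hφ s).differentiableAt.differentiableWithinAt) fun s hs => ?_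
    rw [interior_Icc] at hs
    have hlip := hL (x + s • h) x
    rw [add_sub_cancel_left, norm_smul, Real.norm_of_nonneg hs.1.le] at hlip
    rw [(hφ s).deriv, sub_nonpos]
    calc inner ℝ (gradient f (x + s • h) - gradient f x) h
        ≤ ‖gradient f (x + s • h) - gradient f x‖ * ‖h‖ := real_inner_le_norm _ _
      _ ≤ K * (s * ‖h‖) * ‖h‖ := by gcongr
      _ = K * ‖h‖ ^ 2 * s := by ring
  have h01 := hanti (Set.left_mem_Icc.2 zero_le_one) (Set.right_mem_Icc.2 zero_le_one) zero_le_one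
  simp only [φ, zero_smul, add_zero, one_smul, hh, add_sub_cancel] at h01
  linarith

lemma abs_sub_sub_inner_gradient_le {f : V → ℝ} {K : ℝ} (hf : Differentiable ℝ f)
    (hL : ∀ x y, ‖gradient f x - gradient f y‖ ≤ K * ‖x - y‖) (x y : V) :
    |f y - f x - inner ℝ (gradient f x) (y - x)| ≤ K / 2 * ‖y - x‖ ^ 2 := by
  have hneg (x : V) : gradient (-f) x = -gradient f x := by
    simp only [gradient, fderiv_neg, map_neg]
  have hle := sub_sub_inner_gradient_le hf hL x y
  have hge := sub_sub_inner_gradient_le (K := K) hf.neg (fun x y => by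
    rw [hneg, hneg, ← neg_sub', norm_neg]
    exact hL x y) x y
  simp only [hneg, inner_neg_left, Pi.neg_apply] at hge
  exact abs_le.2 ⟨by linarith, hle⟩

end LipschitzGradient

section Problem

variable {Ξ : Type*} [MeasurableSpace Ξ] {P : Measure Ξ} {F : E n → Ξ → ℝ} {L : Ξ → ℝ} {σ : ℝ}

lemma IsProblem.ae_abs_sub_sub_inner_gradient_le (hP : IsProblem F P L σ) : ∀ᵐ ξ ∂P, ∀ x y : E n,
    |F y ξ - F x ξ - inner ℝ (gradient (fun u => F u ξ) x) (y - x)| ≤ L ξ / 2 * ‖y - x‖ ^ 2 := by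
  filter_upwards [hP.lipschitz, hP.differentiable] with ξ hL hF
  exact abs_sub_sub_inner_gradient_le hF hL

-- A directional derivative is an almost sure limit of the measurable difference quotients.
lemma IsProblem.aestronglyMeasurable_inner_gradient (hP : IsProblem F P L σ) (x v : E n) :
    AEStronglyMeasurable (fun ξ => inner ℝ (gradient (fun u => F u ξ) x) v) P := by
  have hF (s : ℝ) := ((hP.integrable (x + s • v)).sub (hP.integrable x)).const_mul s⁻¹
  refine aestronglyMeasurable_of_tendsto_ae (nhdsWithin (0 : ℝ) {0}ᶜ)
    (fun s => (hF s).aestronglyMeasurable) ?_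
  filter_upwards [hP.differentiable] with ξ hξ
  simpa [hasDerivAt_iff_tendsto_slope_zero] using hasDerivAt_comp_add_smul hξ x v 0

lemma IsProblem.integrable_inner_gradient [IsFiniteMeasure P] (hP : IsProblem F P L σ)
    (x v : E n) : Integrable (fun ξ => inner ℝ (gradient (fun u => F u ξ) x) v) P := by
  have hbound : Integrable (fun ξ => |F (x + v) ξ - F x ξ| + L ξ / 2 * ‖v‖ ^ 2) P :=
    ((hP.integrable _).sub (hP.integrable _)).abs.add
      (((hP.memLp.integrable one_le_two).div_const 2).mul_const _)
  refine hbound.mono' (hP.aestronglyMeasurable_inner_gradient x v) ?_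
  filter_upwards [hP.ae_abs_sub_sub_inner_gradient_le] with ξ hξ
  have htaylor := hξ x (x + v)
  rw [add_sub_cancel_left, abs_sub_comm] at htaylor
  rw [Real.norm_eq_abs]
  linarith [abs_sub_abs_le_abs_sub (inner ℝ (gradient (fun u => F u ξ) x) v) (F (x + v) ξ - F x ξ)]

lemma IsProblem.integrable_gradient [IsFiniteMeasure P] (hP : IsProblem F P L σ) (x : E n) :
    Integrable (fun ξ => gradient (fun u => F u ξ) x) P := by
  let b := EuclideanSpace.basisFun (Fin n) ℝ
  have hsum : Integrable (fun ξ => ∑ i, inner ℝ (b i) (gradient (fun u => F u ξ) x) • b i) P := by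
    simp only [real_inner_comm _ (b _)]
    exact integrable_finsetSum _ fun i _ => (hP.integrable_inner_gradient x (b i)).smul_const _
  simpa only [b.sum_repr'] using hsum

lemma IsProblem.abs_objective_sub_sub_le [IsFiniteMeasure P] (hP : IsProblem F P L σ) (x y : E n) :
    |objective F P y - objective F P x -
      inner ℝ (∫ ξ, gradient (fun u => F u ξ) x ∂P) (y - x)| ≤
        (∫ ξ, L ξ ∂P) / 2 * ‖y - x‖ ^ 2 := by
  have hgrad := hP.integrable_inner_gradient x (y - x)
  have hdiff : Integrable (fun ξ => F y ξ - F x ξ) P := (hP.integrable y).sub (hP.integrable x)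
  have hmean : inner ℝ (∫ ξ, gradient (fun u => F u ξ) x ∂P) (y - x) =
      ∫ ξ, inner ℝ (gradient (fun u => F u ξ) x) (y - x) ∂P := by
    simp only [real_inner_comm (y - x)]
    exact (integral_inner (hP.integrable_gradient x) (y - x)).symm
  rw [objective, objective, hmean, ← integral_sub (hP.integrable y) (hP.integrable x),
    ← integral_sub hdiff hgrad, ← integral_div, ← integral_mul_const]
  refine abs_integral_le_integral_abs.trans <| integral_mono_ae (hdiff.sub hgrad).abs
    (((hP.memLp.integrable one_le_two).div_const 2).mul_const _) ?_
  filter_upwards [hP.ae_abs_sub_sub_inner_gradient_le] with ξ hξ using hξ x y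

lemma IsProblem.hasGradientAt_objective [IsFiniteMeasure P] (hP : IsProblem F P L σ) (x : E n) :
    HasGradientAt (objective F P) (∫ ξ, gradient (fun u => F u ξ) x ∂P) x := by
  rw [hasGradientAt_iff_isLittleO]
  refine Asymptotics.IsBigO.trans_isLittleO (g := fun y => ‖y - x‖ ^ 2) ?_
    (Asymptotics.isLittleO_pow_sub_sub x one_lt_two)
  refine .of_bound ((∫ ξ, L ξ ∂P) / 2) (.of_forall fun y => ?_)
  rw [Real.norm_eq_abs, Real.norm_of_nonneg (sq_nonneg _)]
  exact hP.abs_objective_sub_sub_le x y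

lemma IsProblem.gradient_objective [IsFiniteMeasure P] (hP : IsProblem F P L σ) (x : E n) :
    gradient (objective F P) x = ∫ ξ, gradient (fun u => F u ξ) x ∂P :=
  (hP.hasGradientAt_objective x).gradient

lemma IsProblem.differentiable_objective [IsFiniteMeasure P] (hP : IsProblem F P L σ) :
    Differentiable ℝ (objective F P) :=
  fun x => (hP.hasGradientAt_objective x).differentiableAt

lemma L2_sq (L : Ξ → ℝ) (P : Measure Ξ) : L2 L P ^ 2 = ∫ ξ, L ξ ^ 2 ∂P :=
  Real.sq_sqrt (integral_nonneg fun _ => sq_nonneg _)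

lemma integral_le_L2 [IsProbabilityMeasure P] (hL : MemLp L 2 P) : ∫ ξ, L ξ ∂P ≤ L2 L P := by
  refine Real.le_sqrt_of_sq_le ?_
  have hvar := variance_nonneg L P
  rw [variance_eq_sub hL] at hvar
  simpa using hvar

lemma IsProblem.objective_le [IsProbabilityMeasure P] (hP : IsProblem F P L σ) (x y : E n) :
    objective F P y ≤ objective F P x + inner ℝ (gradient (objective F P) x) (y - x) +
      L2 L P / 2 * ‖y - x‖ ^ 2 := by
  have htaylor := (abs_le.1 (hP.abs_objective_sub_sub_le x y)).2
  have hL2 : (∫ ξ, L ξ ∂P) / 2 * ‖y - x‖ ^ 2 ≤ L2 L P / 2 * ‖y - x‖ ^ 2 := by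
    gcongr
    exact integral_le_L2 hP.memLp
  rw [hP.gradient_objective]
  linarith

lemma IsProblem.le_objective [IsFiniteMeasure P] (hP : IsProblem F P L σ) (x y : E n) :
    objective F P x + inner ℝ (gradient (objective F P) x) (y - x) ≤ objective F P y := by
  have hmid (s : ℝ) := hP.convex.2 (Set.mem_univ (x + s • (y - x))) (Set.mem_univ x)
    one_half_pos.le one_half_pos.le (add_halves 1)
  have hgrad := fderiv_apply_add_le_of_midpoint (M := 0) (h := y - x)
    (hP.differentiable_objective x) fun s => by
      have hs := hmid s
      rw [show (1 / 2 : ℝ) • (x + s • (y - x)) + (1 / 2 : ℝ) • x = x + (s / 2) • (y - x) by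
        module] at hs
      simp only [smul_eq_mul] at hs
      linarith
  rw [add_sub_cancel] at hgrad
  rw [inner_gradient_left]
  linarith

/-- The stochastic error `∇F(x, ξ) - ∇f(x)`, a centred vector of variance at most `σ²`. -/
noncomputable def gradNoise (F : E n → Ξ → ℝ) (P : Measure Ξ) (x : E n) (ξ : Ξ) : E n :=
  gradient (fun u => F u ξ) x - gradient (objective F P) x

lemma IsProblem.integral_gradNoise [IsProbabilityMeasure P] (hP : IsProblem F P L σ) (x : E n) :
    ∫ ξ, gradNoise F P x ξ ∂P = 0 := by
  simp only [gradNoise]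
  rw [integral_sub (hP.integrable_gradient x) (integrable_const _), hP.gradient_objective]
  simp

lemma IsProblem.memLp_gradNoise [IsFiniteMeasure P] (hP : IsProblem F P L σ) (x : E n) :
    MemLp (gradNoise F P x) 2 P := by
  refine ⟨((hP.integrable_gradient x).sub (integrable_const _)).aestronglyMeasurable, ?_⟩
  rw [eLpNorm_lt_top_iff_lintegral_rpow_enorm_lt_top two_ne_zero ENNReal.ofNat_ne_top]
  exact lt_of_le_of_lt (by simpa [gradNoise] using hP.variance x) ENNReal.ofReal_lt_top

lemma IsProblem.integral_norm_gradNoise_sq_le [IsFiniteMeasure P] (hP : IsProblem F P L σ)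
    (x : E n) : ∫ ξ, ‖gradNoise F P x ξ‖ ^ 2 ∂P ≤ σ ^ 2 := by
  have hint := (hP.memLp_gradNoise x).integrable_norm_pow two_ne_zero
  rw [← ENNReal.ofReal_le_ofReal_iff (sq_nonneg σ),
    ofReal_integral_eq_lintegral_ofReal hint (.of_forall fun ξ => sq_nonneg _)]
  simpa only [ENNReal.ofReal_pow (norm_nonneg _), ofReal_norm, gradNoise] using hP.variance x

end Problem

section Batch

variable {Ξ : Type*} {m : ℕ}

/-- The mean `m⁻¹ ∑ᵢ X(ξᵢ)` of `X` over a batch; it vanishes for the empty batch. -/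
noncomputable def batchMean {V : Type*} [AddCommGroup V] [Module ℝ V] (X : Ξ → V)
    (ξ : Fin m → Ξ) : V :=
  (1 / (m : ℝ)) • ∑ i, X (ξ i)

lemma batchMean_sq_le {Y Z : Ξ → ℝ} {ξ : Fin m → Ξ} (h : ∀ i, Y (ξ i) ^ 2 ≤ Z (ξ i)) :
    batchMean Y ξ ^ 2 ≤ batchMean Z ξ := by
  simp only [batchMean, smul_eq_mul, one_div_mul_eq_div]
  calc ((∑ i, Y (ξ i)) / m) ^ 2 ≤ (∑ i, Y (ξ i) ^ 2) / m := by
        simpa using sum_div_card_sq_le_sum_sq_div_card (s := Finset.univ) (f := fun i => Y (ξ i))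
    _ ≤ (∑ i, Z (ξ i)) / m := by
        gcongr with i
        exact h i

variable [MeasurableSpace Ξ] {P : Measure Ξ} [IsProbabilityMeasure P]
  {V : Type*} [NormedAddCommGroup V]

lemma ae_pi_eval (i : Fin m) {p : Ξ → Prop} (hp : ∀ᵐ ξ ∂P, p ξ) :
    ∀ᵐ ξ ∂(Measure.pi fun _ : Fin m => P), p (ξ i) :=
  (measurePreserving_eval (fun _ : Fin m => P) i).quasiMeasurePreserving.ae hp

lemma integral_pi_eval [NormedSpace ℝ V] {X : Ξ → V} (hX : AEStronglyMeasurable X P) (i : Fin m) :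
    ∫ ξ, X (ξ i) ∂(Measure.pi fun _ : Fin m => P) = ∫ ξ, X ξ ∂P := by
  have hpres := measurePreserving_eval (fun _ : Fin m => P) i
  rw [← hpres.map_eq] at hX
  rw [← integral_map hpres.aemeasurable hX, hpres.map_eq]

lemma memLp_batchMean [NormedSpace ℝ V] {p : ENNReal} {X : Ξ → V} (hX : MemLp X p P) :
    MemLp (batchMean X) p (Measure.pi fun _ : Fin m => P) :=
  (memLp_finsetSum _ fun i _ =>
    hX.comp_measurePreserving (measurePreserving_eval (fun _ : Fin m => P) i)).const_smul _

lemma integrable_batchMean [NormedSpace ℝ V] {X : Ξ → V} (hX : Integrable X P) :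
    Integrable (batchMean X) (Measure.pi fun _ : Fin m => P) :=
  memLp_one_iff_integrable.1 (memLp_batchMean (memLp_one_iff_integrable.2 hX))

lemma integral_batchMean [NormedSpace ℝ V] [NeZero m] {X : Ξ → V} (hX : Integrable X P) :
    ∫ ξ, batchMean X ξ ∂(Measure.pi fun _ : Fin m => P) = ∫ ξ, X ξ ∂P := by
  simp only [batchMean]
  have hint (i : Fin m) : Integrable (fun ξ : Fin m → Ξ => X (ξ i)) (Measure.pi fun _ => P) :=
    (measurePreserving_eval (fun _ : Fin m => P) i).integrable_comp_of_integrable hX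
  rw [integral_smul, integral_finsetSum _ fun i _ => hint i]
  simp [integral_pi_eval hX.aestronglyMeasurable, ← Nat.cast_smul_eq_nsmul ℝ, smul_smul]

variable [InnerProductSpace ℝ V] [CompleteSpace V] [MeasurableSpace V] [BorelSpace V]

lemma integral_inner_eval_eval_of_ne {X : Ξ → V} (hX : Integrable X P) (hmean : ∫ ξ, X ξ ∂P = 0)
    {i j : Fin m} (hij : i ≠ j) :
    ∫ ξ, inner ℝ (X (ξ i)) (X (ξ j)) ∂(Measure.pi fun _ : Fin m => P) = 0 := by
  have hint (i : Fin m) :=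
    (measurePreserving_eval (fun _ : Fin m => P) i).integrable_comp_of_integrable hX
  have hindep := (iIndepFun_pi fun _ : Fin m => hX.aemeasurable).indepFun hij
  refine (hindep.integral_bilin (hint i) (hint j) (innerSL ℝ)).trans ?_
  rw [integral_pi_eval hX.aestronglyMeasurable, hmean, map_zero, zero_apply]

lemma integral_norm_batchMean_sq [NeZero m] {X : Ξ → V} (hX : MemLp X 2 P)
    (hmean : ∫ ξ, X ξ ∂P = 0) :
    ∫ ξ, ‖batchMean X ξ‖ ^ 2 ∂(Measure.pi fun _ : Fin m => P) = (∫ ξ, ‖X ξ‖ ^ 2 ∂P) / m := by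
  have hXi (i : Fin m) := hX.comp_measurePreserving (measurePreserving_eval (fun _ : Fin m => P) i)
  have hint (i j : Fin m) : Integrable (fun ξ : Fin m → Ξ => inner ℝ (X (ξ i)) (X (ξ j)))
      (Measure.pi fun _ => P) :=
    ((hXi i).norm.integrable_mul (hXi j).norm).mono'
      ((hXi i).aestronglyMeasurable.inner (hXi j).aestronglyMeasurable)
      (.of_forall fun ξ => norm_inner_le_norm _ _)
  have hpair (i j : Fin m) : ∫ ξ, inner ℝ (X (ξ i)) (X (ξ j)) ∂(Measure.pi fun _ : Fin m => P) =
      if i = j then ∫ ξ, ‖X ξ‖ ^ 2 ∂P else 0 := by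
    split_ifs with hij
    · simp only [hij, real_inner_self_eq_norm_sq]
      exact integral_pi_eval (hX.aestronglyMeasurable.norm.pow 2) j
    · exact integral_inner_eval_eval_of_ne (hX.integrable one_le_two) hmean hij
  have hsq (ξ : Fin m → Ξ) : ‖batchMean X ξ‖ ^ 2 =
      (1 / (m : ℝ)) ^ 2 * ∑ i, ∑ j, inner ℝ (X (ξ i)) (X (ξ j)) := by
    rw [batchMean, norm_smul, mul_pow, ← real_inner_self_eq_norm_sq (∑ i, X (ξ i)), inner_sum]
    simp only [sum_inner, Real.norm_eq_abs, sq_abs]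
    rw [Finset.sum_comm]
  simp only [hsq]
  rw [integral_const_mul,
    integral_finsetSum _ fun i _ => integrable_finsetSum _ fun j _ => hint i j]
  simp only [integral_finsetSum _ fun j _ => hint _ j, hpair, Finset.sum_ite_eq, Finset.mem_univ,
    if_true, Finset.sum_const, Finset.card_univ, Fintype.card_fin, nsmul_eq_mul]
  have hm : (m : ℝ) ≠ 0 := NeZero.ne _
  field_simp

end Batch

section SphereProd

variable {Ω : Type*} [MeasurableSpace Ω] {π : Measure Ω} [NeZero n]
  {H K : Ω → E n} {w : E n → ℝ}

lemma integrable_inner_mul_inner_mul_prod (hH : MemLp H 2 π) (hK : MemLp K 2 π)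
    (hw : Continuous w) :
    Integrable (fun a : E n × Ω => inner ℝ (H a.2) a.1 * inner ℝ (K a.2) a.1 * w a.1)
      ((sphereLaw n).prod π) := by
  have hfst : AEStronglyMeasurable (Prod.fst : E n × Ω → E n) ((sphereLaw n).prod π) :=
    measurable_fst.aestronglyMeasurable
  have hmeas {X : Ω → E n} (hX : MemLp X 2 π) :
      AEStronglyMeasurable (fun a : E n × Ω => inner ℝ (X a.2) a.1) ((sphereLaw n).prod π) :=
    hX.aestronglyMeasurable.comp_snd.inner hfst
  refine ((integrable_sphereLaw hw).norm.mul_prod (hH.norm.integrable_mul hK.norm)).mono'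
    (((hmeas hH).mul (hmeas hK)).mul (hw.comp_aestronglyMeasurable hfst)) ?_
  filter_upwards [Measure.quasiMeasurePreserving_fst.ae (ae_norm_eq_one n)] with a ha
  have hinner (x : E n) : ‖inner ℝ x a.1‖ ≤ ‖x‖ := by
    simpa [ha] using norm_inner_le_norm (𝕜 := ℝ) x a.1
  rw [norm_mul, norm_mul, mul_comm]
  exact mul_le_mul_of_nonneg_left
    (mul_le_mul (hinner _) (hinner _) (norm_nonneg _) (norm_nonneg _)) (norm_nonneg _)

lemma integral_inner_mul_inner_mul_prod [SFinite π] (hH : MemLp H 2 π) (hK : MemLp K 2 π)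
    (hw : Continuous w)
    (hiso : ∀ u v : E n, ∫ e, inner ℝ u e * inner ℝ v e * w e ∂sphereLaw n =
      inner ℝ u v / n * ∫ e, w e ∂sphereLaw n) :
    ∫ a, inner ℝ (H a.2) a.1 * inner ℝ (K a.2) a.1 * w a.1 ∂(sphereLaw n).prod π =
      (∫ ω, inner ℝ (H ω) (K ω) ∂π) / n * ∫ e, w e ∂sphereLaw n := by
  rw [integral_prod_symm _ (integrable_inner_mul_inner_mul_prod hH hK hw)]
  simp only [hiso]
  rw [integral_mul_const, integral_div]

lemma integrable_inner_mul_inner_prod (hH : MemLp H 2 π) (hK : MemLp K 2 π) :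
    Integrable (fun a : E n × Ω => inner ℝ (H a.2) a.1 * inner ℝ (K a.2) a.1)
      ((sphereLaw n).prod π) := by
  simpa using integrable_inner_mul_inner_mul_prod hH hK (w := fun _ => 1) continuous_const

lemma integral_inner_mul_inner_prod [SFinite π] (hH : MemLp H 2 π) (hK : MemLp K 2 π) :
    ∫ a, inner ℝ (H a.2) a.1 * inner ℝ (K a.2) a.1 ∂(sphereLaw n).prod π =
      (∫ ω, inner ℝ (H ω) (K ω) ∂π) / n := by
  simpa using integral_inner_mul_inner_mul_prod hH hK (w := fun _ => 1) continuous_const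
    (by simp [integral_inner_mul_inner])

lemma integrable_inner_sq_prod (hH : MemLp H 2 π) :
    Integrable (fun a : E n × Ω => inner ℝ (H a.2) a.1 ^ 2) ((sphereLaw n).prod π) := by
  simpa only [sq] using integrable_inner_mul_inner_prod hH hH

lemma integral_inner_sq_prod [SFinite π] (hH : MemLp H 2 π) :
    ∫ a, inner ℝ (H a.2) a.1 ^ 2 ∂(sphereLaw n).prod π = (∫ ω, ‖H ω‖ ^ 2 ∂π) / n := by
  simpa only [sq (inner ℝ _ _), real_inner_self_eq_norm_sq] using
    integral_inner_mul_inner_prod hH hH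

variable {q : ENNReal}

lemma integrable_inner_sq_mul_pNorm_sq_prod (hq : 1 ≤ q) (hH : MemLp H 2 π) :
    Integrable (fun a : E n × Ω => inner ℝ (H a.2) a.1 ^ 2 * pNorm q a.1 ^ 2)
      ((sphereLaw n).prod π) := by
  simpa only [sq (inner ℝ _ _)] using
    integrable_inner_mul_inner_mul_prod hH hH (w := fun e => pNorm q e ^ 2)
      ((continuous_pNorm hq).pow 2)

lemma integral_inner_sq_mul_pNorm_sq_prod [SFinite π] (hq : 1 ≤ q) (hH : MemLp H 2 π) :
    ∫ a, inner ℝ (H a.2) a.1 ^ 2 * pNorm q a.1 ^ 2 ∂(sphereLaw n).prod π =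
      (∫ ω, ‖H ω‖ ^ 2 ∂π) / n * ∫ e, pNorm q e ^ 2 ∂sphereLaw n := by
  simpa only [sq (inner ℝ _ _), real_inner_self_eq_norm_sq] using
    integral_inner_mul_inner_mul_prod hH hH (w := fun e => pNorm q e ^ 2)
      ((continuous_pNorm hq).pow 2) (integral_inner_mul_inner_mul_pNorm_sq hq)

end SphereProd

section DirectionalEstimate

variable {Ω : Type*} [MeasurableSpace Ω] {π : Measure Ω} {g h x e : E n} {H : Ω → E n}
  {R : Ω → ℝ} {γ : E n × Ω → ℝ} {ℓ α N r c : ℝ}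

/-- `γ (e, ω)` estimates the directional derivative `⟨g, e⟩` up to the centred noise `⟨H ω, e⟩`
and an error whose square is at most `R ω`, for almost every pair of a direction `e` on the
sphere and an outcome `ω`. -/
structure IsDirectionalEstimate (π : Measure Ω) (g : E n) (γ : E n × Ω → ℝ) (H : Ω → E n)
    (R : Ω → ℝ) : Prop where
  measurable : Measurable γ
  memLp : MemLp H 2 π
  integral_eq_zero : ∫ ω, H ω ∂π = 0
  integrable : Integrable R π
  norm_eq_one_and_sq_le : ∀ᵐ a ∂(sphereLaw n).prod π,
    ‖a.1‖ = 1 ∧ (γ a - inner ℝ (g + H a.2) a.1) ^ 2 ≤ R a.2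

lemma apply_gradient_step_le {f : E n → ℝ}
    (hf : ∀ y, f y ≤ f x + inner ℝ g (y - x) + ℓ / 2 * ‖y - x‖ ^ 2) (hℓ : 0 < ℓ) (he : ‖e‖ = 1)
    (hr : (c - inner ℝ (g + h) e) ^ 2 ≤ r) :
    f (x - (1 / (2 * ℓ)) • (c • e)) ≤
      f x - inner ℝ g e ^ 2 / (4 * ℓ) + (inner ℝ h e ^ 2 + r) / (2 * ℓ) := by
  have hstep := hf (x - (1 / (2 * ℓ)) • (c • e))
  rw [show x - (1 / (2 * ℓ)) • (c • e) - x = (-(1 / (2 * ℓ) * c)) • e by module,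
    real_inner_smul_right, norm_smul, he, mul_one, Real.norm_eq_abs, sq_abs] at hstep
  rw [inner_add_left] at hr
  refine hstep.trans ?_
  field_simp
  nlinarith [sq_nonneg c, sq_nonneg (c - inner ℝ g e - 2 * inner ℝ h e)]

lemma bregman_mirrorStep_smul_le {p q : ENNReal} {d : E n → ℝ} (hp : 1 ≤ p) (hp2 : p ≤ 2)
    (hpq : p⁻¹ + q⁻¹ = 1) (hd : IsProxFunction p d) (hN : 0 < N)
    (hr : (c - inner ℝ (g + h) e) ^ 2 ≤ r) (α : ℝ) (z u : E n) :
    bregman d (mirrorStep d (α * n) (c • e) z) u ≤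
      bregman d z u - α * n * (inner ℝ (g + h) e * inner ℝ (z - u) e) +
        n / (2 * N) * inner ℝ (z - u) e ^ 2 + α ^ 2 * n * N / 2 * r +
        α ^ 2 * n ^ 2 * (inner ℝ g e ^ 2 * pNorm q e ^ 2 +
          2 * (inner ℝ h e ^ 2 * pNorm q e ^ 2) + 2 * (r * pNorm q e ^ 2)) := by
  have hq1 : 1 ≤ q := one_le_two.trans (two_le_of_inv_add_inv_eq_one hp2 hpq)
  have hmirror := bregman_mirrorStep_le hp hp2 hpq hd (α * n) (c • e) z u
  rw [real_inner_smul_left, pNorm_smul hq1, real_inner_comm, mul_pow |c|, sq_abs] at hmirror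
  set a : ℝ := inner ℝ g e
  set b : ℝ := inner ℝ h e
  set v : ℝ := inner ℝ (z - u) e
  rw [inner_add_left] at hr ⊢
  have hcsq : c ^ 2 ≤ 2 * (a ^ 2 + 2 * b ^ 2 + 2 * r) := by
    nlinarith [sq_nonneg (c - 2 * a), sq_nonneg (c - a - 2 * b)]
  have hquad : (α * n) ^ 2 / 2 * (c ^ 2 * pNorm q e ^ 2) ≤
      (α * n) ^ 2 / 2 * (2 * (a ^ 2 + 2 * b ^ 2 + 2 * r) * pNorm q e ^ 2) := by gcongr
  have hyoung : -(α * (c - (a + b)) * v) ≤ v ^ 2 / (2 * N) + α ^ 2 * N / 2 * r := by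
    have hαr : (α * N) ^ 2 * (c - (a + b)) ^ 2 ≤ (α * N) ^ 2 * r := by gcongr
    rw [show v ^ 2 / (2 * N) + α ^ 2 * N / 2 * r = (v ^ 2 + (α * N) ^ 2 * r) / (2 * N) by
      field_simp, le_div_iff₀ (by positivity)]
    nlinarith [sq_nonneg (v + α * N * (c - (a + b)))]
  have hcross := mul_le_mul_of_nonneg_left hyoung (Nat.cast_nonneg n)
  have hcross_eq : (n : ℝ) * (v ^ 2 / (2 * N) + α ^ 2 * N / 2 * r) =
      n / (2 * N) * v ^ 2 + α ^ 2 * n * N / 2 * r := by ring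
  nlinarith

lemma IsDirectionalEstimate.integral_apply_gradient_step_le [NeZero n] [IsProbabilityMeasure π]
    (hγ : IsDirectionalEstimate π g γ H R) {f : E n → ℝ} (hfc : Continuous f) {b : ℝ}
    (hb : ∀ y, b ≤ f y) (hf : ∀ y, f y ≤ f x + inner ℝ g (y - x) + ℓ / 2 * ‖y - x‖ ^ 2)
    (hℓ : 0 < ℓ) :
    Integrable (fun a : E n × Ω => f (x - (1 / (2 * ℓ)) • (γ a • a.1))) ((sphereLaw n).prod π) ∧
    ∫ a, f (x - (1 / (2 * ℓ)) • (γ a • a.1)) ∂(sphereLaw n).prod π ≤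
      f x - ‖g‖ ^ 2 / (4 * ℓ * n) +
        ((∫ ω, ‖H ω‖ ^ 2 ∂π) / n + ∫ ω, R ω ∂π) / (2 * ℓ) := by
  have hle : ∀ᵐ a ∂(sphereLaw n).prod π, f (x - (1 / (2 * ℓ)) • (γ a • a.1)) ≤
      f x - inner ℝ g a.1 ^ 2 / (4 * ℓ) + (inner ℝ (H a.2) a.1 ^ 2 + R a.2) / (2 * ℓ) := by
    filter_upwards [hγ.norm_eq_one_and_sq_le] with a ha using
      apply_gradient_step_le hf hℓ ha.1 ha.2
  have hg := (integrable_inner_sq_prod (n := n) (memLp_const (μ := π) g)).div_const (4 * ℓ)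
  have hH := integrable_inner_sq_prod hγ.memLp
  have hR : Integrable (fun a : E n × Ω => R a.2) ((sphereLaw n).prod π) :=
    hγ.integrable.comp_snd (sphereLaw n)
  have hfg := (integrable_const (f x)).sub hg
  have hHR := (hH.add hR).div_const (2 * ℓ)
  have hmeas : Measurable fun a : E n × Ω => f (x - (1 / (2 * ℓ)) • (γ a • a.1)) :=
    hfc.measurable.comp
      (measurable_const.sub ((hγ.measurable.smul measurable_fst).const_smul (1 / (2 * ℓ))))
  have hint := integrable_of_le_of_le hmeas.aestronglyMeasurable (.of_forall fun _ => hb _) hle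
    (integrable_const b) (hfg.add hHR)
  refine ⟨hint, (integral_mono_ae hint (hfg.add hHR) hle).trans_eq ?_⟩
  rw [integral_add' hfg hHR, integral_sub' (integrable_const _) hg, integral_div, integral_div,
    integral_add' hH hR, integral_inner_sq_prod (memLp_const g), integral_inner_sq_prod hγ.memLp,
    integral_fun_snd]
  simp only [integral_const, probReal_univ, one_smul]
  field_simp

lemma IsDirectionalEstimate.integral_inner_mul_inner [NeZero n] [IsProbabilityMeasure π]
    (hγ : IsDirectionalEstimate π g γ H R) (v : E n) :
    ∫ a, inner ℝ (g + H a.2) a.1 * inner ℝ v a.1 ∂(sphereLaw n).prod π = inner ℝ g v / n := by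
  have hH : Integrable H π := hγ.memLp.integrable one_le_two
  rw [integral_inner_mul_inner_prod (H := fun ω => g + H ω) ((memLp_const g).add hγ.memLp)
    (memLp_const v)]
  simp only [real_inner_comm v]
  rw [integral_inner (f := fun ω => g + H ω) ((integrable_const g).add hH) v,
    integral_add (integrable_const g) hH, hγ.integral_eq_zero]
  simp

lemma IsDirectionalEstimate.integral_bregman_mirrorStep_le [NeZero n] [IsProbabilityMeasure π]
    (hγ : IsDirectionalEstimate π g γ H R) {p q : ENNReal} {d : E n → ℝ}
    (hp : 1 ≤ p) (hp2 : p ≤ 2) (hpq : p⁻¹ + q⁻¹ = 1) (hd : IsProxFunction p d) (hN : 0 < N)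
    (α : ℝ) (z u : E n) :
    Integrable (fun a : E n × Ω => bregman d (mirrorStep d (α * n) (γ a • a.1) z) u)
      ((sphereLaw n).prod π) ∧
    ∫ a, bregman d (mirrorStep d (α * n) (γ a • a.1) z) u ∂(sphereLaw n).prod π ≤
      bregman d z u - α * inner ℝ g (z - u) + ‖z - u‖ ^ 2 / (2 * N) +
        α ^ 2 * n * N / 2 * ∫ ω, R ω ∂π +
        α ^ 2 * n ^ 2 * (∫ e, pNorm q e ^ 2 ∂sphereLaw n) *
          (‖g‖ ^ 2 / n + 2 * ((∫ ω, ‖H ω‖ ^ 2 ∂π) / n) + 2 * ∫ ω, R ω ∂π) := by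
  have hq1 : 1 ≤ q := one_le_two.trans (two_le_of_inv_add_inv_eq_one hp2 hpq)
  have hle := hγ.norm_eq_one_and_sq_le.mono fun a ha =>
    bregman_mirrorStep_smul_le hp hp2 hpq hd hN ha.2 α z u
  have hgv := integrable_inner_mul_inner_prod (n := n) (H := fun ω => g + H ω)
    ((memLp_const g).add hγ.memLp) (memLp_const (z - u))
  have hv := integrable_inner_sq_prod (n := n) (memLp_const (μ := π) (z - u))
  have hR : Integrable (fun a : E n × Ω => R a.2) ((sphereLaw n).prod π) :=
    hγ.integrable.comp_snd (sphereLaw n)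
  have hgw := integrable_inner_sq_mul_pNorm_sq_prod hq1 (memLp_const (μ := π) g)
  have hHw := integrable_inner_sq_mul_pNorm_sq_prod hq1 hγ.memLp
  have hw : Integrable (fun e : E n => pNorm q e ^ 2) (sphereLaw n) :=
    integrable_sphereLaw ((continuous_pNorm hq1).pow 2)
  have hRw : Integrable (fun a : E n × Ω => R a.2 * pNorm q a.1 ^ 2) ((sphereLaw n).prod π) := by
    simpa only [mul_comm] using hw.mul_prod hγ.integrable
  have hconst := (integrable_const (bregman d z u)).sub (hgv.const_mul (α * n))
  have hvar := hconst.add (hv.const_mul (n / (2 * N)))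
  have hlin := hvar.add (hR.const_mul (α ^ 2 * n * N / 2))
  have hquad := (hgw.add (hHw.const_mul 2)).add (hRw.const_mul 2)
  have hT := hlin.add (hquad.const_mul (α ^ 2 * n ^ 2))
  have hmeas : Measurable fun a : E n × Ω => bregman d (mirrorStep d (α * n) (γ a • a.1) z) u :=
    (measurable_bregman hd.differentiable.continuous.measurable u).comp
      (measurable_mirrorStep hp hp2 hd _ (hγ.measurable.smul measurable_fst) measurable_const)
  have hint := integrable_of_le_of_le hmeas.aestronglyMeasurable
    (.of_forall fun _ => bregman_nonneg hd _ _) hle (integrable_const 0) hT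
  refine ⟨hint, (integral_mono_ae hint hT hle).trans_eq ?_⟩
  rw [integral_add' hlin (hquad.const_mul _), integral_add' hvar (hR.const_mul _),
    integral_add' hconst (hv.const_mul _), integral_sub' (integrable_const _) (hgv.const_mul _),
    integral_const_mul, integral_const_mul, integral_const_mul, integral_const_mul,
    integral_add' (hgw.add (hHw.const_mul 2)) (hRw.const_mul 2),
    integral_add' hgw (hHw.const_mul 2), integral_const_mul, integral_const_mul,
    hγ.integral_inner_mul_inner,
    integral_inner_sq_prod (memLp_const (z - u)),
    integral_inner_sq_mul_pNorm_sq_prod hq1 (memLp_const g),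
    integral_inner_sq_mul_pNorm_sq_prod hq1 hγ.memLp, integral_fun_snd]
  simp only [mul_comm (R _), integral_prod_mul (fun e => pNorm q e ^ 2) R, integral_const,
    probReal_univ, one_smul]
  have hn : (n : ℝ) ≠ 0 := NeZero.ne _
  field_simp

lemma IsDirectionalEstimate.integral_error_nonneg [NeZero n] [SFinite π]
    (hγ : IsDirectionalEstimate π g γ H R) : 0 ≤ ∫ ω, R ω ∂π := by
  have h : 0 ≤ ∫ a, R a.2 ∂(sphereLaw n).prod π :=
    integral_nonneg_of_ae (hγ.norm_eq_one_and_sq_le.mono fun a ha => (sq_nonneg _).trans ha.2)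
  rwa [integral_fun_snd, probReal_univ, one_smul] at h

lemma IsDirectionalEstimate.integral_potential_step_le [NeZero n] [IsProbabilityMeasure π]
    (hγ : IsDirectionalEstimate π g γ H R) {p q : ENNReal} {d : E n → ℝ}
    (hp : 1 ≤ p) (hp2 : p ≤ 2) (hpq : p⁻¹ + q⁻¹ = 1) (hd : IsProxFunction p d) (hN : 0 < N)
    {f : E n → ℝ} (hfc : Continuous f) {fs : ℝ} (hfs : ∀ y, fs ≤ f y)
    (hf : ∀ y, f y ≤ f x + inner ℝ g (y - x) + ℓ / 2 * ‖y - x‖ ^ 2) (hℓ : 0 < ℓ) {A α : ℝ}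
    (hA : 16 * ℓ * (α ^ 2 * n ^ 2 * ∫ e, pNorm q e ^ 2 ∂sphereLaw n) ≤ A) (z u : E n) :
    Integrable (fun a : E n × Ω => A * (f (x - (1 / (2 * ℓ)) • (γ a • a.1)) - fs) +
      bregman d (mirrorStep d (α * n) (γ a • a.1) z) u) ((sphereLaw n).prod π) ∧
    ∫ a, (A * (f (x - (1 / (2 * ℓ)) • (γ a • a.1)) - fs) +
      bregman d (mirrorStep d (α * n) (γ a • a.1) z) u) ∂(sphereLaw n).prod π ≤
      A * (f x - fs) - α * inner ℝ g (z - u) + (1 + 1 / N) * bregman d z u +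
        A * ((∫ ω, ‖H ω‖ ^ 2 ∂π) / (n * ℓ)) +
        (5 * A / (8 * ℓ) + α ^ 2 * n * N / 2) * ∫ ω, R ω ∂π := by
  obtain ⟨hfi, hfle⟩ := hγ.integral_apply_gradient_step_le hfc hfs hf hℓ
  obtain ⟨hVi, hVle⟩ := hγ.integral_bregman_mirrorStep_le hp hp2 hpq hd hN α z u
  have hgap := (hfi.sub (integrable_const fs)).const_mul A
  refine ⟨hgap.add hVi, (integral_add hgap hVi).trans_le ?_⟩
  rw [integral_const_mul, integral_sub' hfi (integrable_const fs)]
  simp only [integral_const, probReal_univ, one_smul]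
  have hn : (0 : ℝ) < n := by exact_mod_cast NeZero.pos n
  have hA0 : 0 ≤ A := le_trans (by positivity) hA
  have hT : 0 ≤ ∫ ω, R ω ∂π := hγ.integral_error_nonneg
  have hz : ‖z - u‖ ^ 2 / (2 * N) ≤ 1 / N * bregman d z u := by
    rw [show ‖z - u‖ ^ 2 / (2 * N) = 1 / N * (1 / 2 * ‖u - z‖ ^ 2) by
      rw [norm_sub_rev]; field_simp]
    gcongr
    exact half_norm_sq_le_bregman hp hp2 hd z u
  have hquad : α ^ 2 * n ^ 2 * (∫ e, pNorm q e ^ 2 ∂sphereLaw n) *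
      (‖g‖ ^ 2 / n + 2 * ((∫ ω, ‖H ω‖ ^ 2 ∂π) / n) + 2 * ∫ ω, R ω ∂π) ≤
      A / (16 * ℓ) * (‖g‖ ^ 2 / n + 2 * ((∫ ω, ‖H ω‖ ^ 2 ∂π) / n) + 2 * ∫ ω, R ω ∂π) := by
    gcongr
    rwa [le_div_iff₀' (by positivity)]
  have hg : 0 ≤ A * ‖g‖ ^ 2 / (n * ℓ) := by positivity
  have hH : 0 ≤ A * (∫ ω, ‖H ω‖ ^ 2 ∂π) / (n * ℓ) := by positivity
  have hf' := mul_le_mul_of_nonneg_left hfle hA0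
  ring_nf at hf' hVle hquad hz hg hH ⊢
  linarith

end DirectionalEstimate

section Step

variable {Ξ : Type*} {m : ℕ}

/-- The mean over a batch of the difference quotients of `ft` at `x` along `e`, that is the
coefficient of `e` in the gradient estimate. -/
noncomputable def batchSlope (ft : E n → Ξ → ℝ) (t : ℝ) (x e : E n) (ξ : Fin m → Ξ) : ℝ :=
  batchMean (fun ζ => (ft (x + t • e) ζ - ft x ζ) / t) ξ

lemma gradEst_fst (ft : E n → Ξ → ℝ) (t : ℝ) (x e : E n) (ξ : Fin m → Ξ) :
    (gradEst ft t x e ξ).1 = batchSlope ft t x e ξ • e := by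
  simp only [gradEst, oracleCall, batchSlope, batchMean]
  rw [← Finset.sum_smul, smul_smul, smul_eq_mul]

/-- One iteration of the method on the pair `s = (y, z)`, without the counter of oracle calls. -/
noncomputable def step (ft : E n → Ξ → ℝ) (d : E n → ℝ) (ℓ : ℝ) (α : ℕ → ℝ) (t : ℝ) (k : ℕ)
    (s : E n × E n) (w : E n × (Fin m → Ξ)) : E n × E n :=
  let τ : ℝ := 2 / ((k : ℝ) + 2)
  let x : E n := τ • s.2 + (1 - τ) • s.1
  (x - (1 / (2 * ℓ)) • (gradEst ft t x w.1 w.2).1,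
    mirrorStep d (α (k + 1) * n) (gradEst ft t x w.1 w.2).1 s.2)

/-- The mean over a batch of an upper bound for the squared error of a difference quotient:
the first term comes from the Taylor remainder, the second from the noise of the oracle. -/
noncomputable def batchError (L : Ξ → ℝ) (t Δ : ℝ) (ξ : Fin m → Ξ) : ℝ :=
  batchMean (fun ζ => t ^ 2 / 2 * L ζ ^ 2 + 8 * Δ ^ 2 / t ^ 2) ξ

lemma sq_slope_sub_le {a a' b b' s K t Δ : ℝ} (ht : 0 < t)
    (hTaylor : |a' - a - t * s| ≤ K / 2 * t ^ 2) (hb : |b| ≤ Δ) (hb' : |b'| ≤ Δ) :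
    ((a' + b' - (a + b)) / t - s) ^ 2 ≤ t ^ 2 / 2 * K ^ 2 + 8 * Δ ^ 2 / t ^ 2 := by
  have hTaylor_sq := sq_le_sq' (abs_le.1 hTaylor).1 (abs_le.1 hTaylor).2
  have hnoise_sq : (b' - b) ^ 2 ≤ (2 * Δ) ^ 2 :=
    sq_le_sq' (by linarith [abs_le.1 hb, abs_le.1 hb']) (by linarith [abs_le.1 hb, abs_le.1 hb'])
  calc ((a' + b' - (a + b)) / t - s) ^ 2 = ((a' - a - t * s) + (b' - b)) ^ 2 / t ^ 2 := by
        field_simp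
        ring
    _ ≤ (2 * (K / 2 * t ^ 2) ^ 2 + 2 * (2 * Δ) ^ 2) / t ^ 2 := by
        gcongr
        linarith [add_sq_le (a := a' - a - t * s) (b := b' - b)]
    _ = t ^ 2 / 2 * K ^ 2 + 8 * Δ ^ 2 / t ^ 2 := by
        field_simp
        ring

variable [MeasurableSpace Ξ]

lemma measurable_batchSlope {ft : E n → Ξ → ℝ} (hft : Measurable (Function.uncurry ft)) (t : ℝ)
    {β : Type*} [MeasurableSpace β] {x e : β → E n} {ξ : β → Fin m → Ξ} (hx : Measurable x)
    (he : Measurable e) (hξ : Measurable ξ) :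
    Measurable fun b => batchSlope ft t (x b) (e b) (ξ b) := by
  simp only [batchSlope, batchMean, smul_eq_mul]
  refine (Finset.measurable_sum _ fun i _ => ?_).const_mul _
  have hi : Measurable fun b => ξ b i := (measurable_pi_apply i).comp hξ
  have hshift : Measurable fun b => ft (x b + t • e b) (ξ b i) :=
    hft.comp ((hx.add (he.const_smul t)).prodMk hi)
  have hbase : Measurable fun b => ft (x b) (ξ b i) := hft.comp (hx.prodMk hi)
  exact (hshift.sub hbase).div_const t

lemma measurable_step {p : ENNReal} {ft : E n → Ξ → ℝ} (hft : Measurable (Function.uncurry ft))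
    {d : E n → ℝ} (hp : 1 ≤ p) (hp2 : p ≤ 2) (hd : IsProxFunction p d) (ℓ : ℝ) (α : ℕ → ℝ) (t : ℝ)
    (k : ℕ) :
    Measurable fun a : (E n × E n) × E n × (Fin m → Ξ) => step ft d ℓ α t k a.1 a.2 := by
  simp only [step, gradEst_fst]
  have hx : Measurable fun a : (E n × E n) × E n × (Fin m → Ξ) =>
      (2 / ((k : ℝ) + 2)) • a.1.2 + (1 - 2 / ((k : ℝ) + 2)) • a.1.1 := by fun_prop
  have he : Measurable fun a : (E n × E n) × E n × (Fin m → Ξ) => a.2.1 := by fun_prop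
  have hG := (measurable_batchSlope hft t hx he (measurable_snd.comp measurable_snd)).smul he
  exact (hx.sub (hG.const_smul (1 / (2 * ℓ)))).prodMk
    (measurable_mirrorStep hp hp2 hd _ hG (measurable_snd.comp measurable_fst))

variable {P : Measure Ξ} {F η : E n → Ξ → ℝ} {L : Ξ → ℝ} {σ t Δ : ℝ}

lemma batchSlope_sub_inner [NeZero m] (ft : E n → Ξ → ℝ) (t : ℝ) (x e : E n) (ξ : Fin m → Ξ) :
    batchSlope ft t x e ξ -
        inner ℝ (gradient (objective F P) x + batchMean (gradNoise F P x) ξ) e =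
      batchMean (fun ζ => (ft (x + t • e) ζ - ft x ζ) / t -
        inner ℝ (gradient (fun u => F u ζ) x) e) ξ := by
  have hm : 1 / (m : ℝ) * m = 1 := one_div_mul_cancel (NeZero.ne _)
  simp only [batchSlope, batchMean, gradNoise, smul_eq_mul, Finset.sum_sub_distrib, inner_add_left,
    real_inner_smul_left, inner_sub_left, sum_inner, Finset.sum_const, Finset.card_univ,
    Fintype.card_fin, ← Nat.cast_smul_eq_nsmul ℝ]
  linear_combination inner ℝ (gradient (objective F P) x) e * hm

variable [IsProbabilityMeasure P]

lemma ae_abs_noise_le {μ : Measure (E n)} [IsProbabilityMeasure μ]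
    (hη : Measurable (Function.uncurry η)) (hηΔ : ∀ x, ∀ᵐ ξ ∂P, |η x ξ| ≤ Δ) (x : E n) (i : Fin m) :
    ∀ᵐ w ∂μ.prod (Measure.pi fun _ : Fin m => P), |η (x + t • w.1) (w.2 i)| ≤ Δ := by
  have hmeas : Measurable fun w : E n × (Fin m → Ξ) => η (x + t • w.1) (w.2 i) :=
    hη.comp ((measurable_const.add (measurable_fst.const_smul t)).prodMk
      ((measurable_pi_apply i).comp measurable_snd))
  rw [Measure.ae_prod_iff_ae_ae (measurableSet_le hmeas.abs measurable_const)]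
  exact .of_forall fun e => ae_pi_eval i (hηΔ (x + t • e))

lemma IsProblem.ae_batchSlope_error_sq_le [NeZero n] [NeZero m] (hP : IsProblem F P L σ)
    (hη : Measurable (Function.uncurry η)) (hηΔ : ∀ x, ∀ᵐ ξ ∂P, |η x ξ| ≤ Δ) (ht : 0 < t)
    (x : E n) :
    ∀ᵐ w ∂(sphereLaw n).prod (Measure.pi fun _ : Fin m => P), ‖w.1‖ = 1 ∧
      (batchSlope (fun x ζ => F x ζ + η x ζ) t x w.1 w.2 -
        inner ℝ (gradient (objective F P) x + batchMean (gradNoise F P x) w.2) w.1) ^ 2 ≤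
        batchError L t Δ w.2 := by
  have hnorm := (Measure.quasiMeasurePreserving_fst (ν := Measure.pi fun _ : Fin m => P)).ae
    (ae_norm_eq_one n)
  have hnoise := ae_all_iff.2 fun i : Fin m =>
    ae_abs_noise_le (t := t) (μ := sphereLaw n) hη hηΔ x i
  have hnoise₀ := ae_all_iff.2 fun i : Fin m =>
    ae_abs_noise_le (t := 0) (μ := sphereLaw n) hη hηΔ x i
  have hTaylor := (Measure.quasiMeasurePreserving_snd (μ := sphereLaw n)).ae
    (ae_all_iff.2 fun i : Fin m => ae_pi_eval i hP.ae_abs_sub_sub_inner_gradient_le)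
  filter_upwards [hnorm, hnoise, hnoise₀, hTaylor] with w hw hη₁ hη₀ hT
  refine ⟨hw, ?_⟩
  rw [batchSlope_sub_inner]
  refine batchMean_sq_le fun i => sq_slope_sub_le ht ?_ (by simpa using hη₀ i) (hη₁ i)
  simpa [real_inner_smul_right, norm_smul, hw] using hT i x (x + t • w.1)

lemma IsProblem.integrable_batchError (hP : IsProblem F P L σ) :
    Integrable (batchError L t Δ) (Measure.pi fun _ : Fin m => P) :=
  integrable_batchMean ((hP.memLp.integrable_sq.const_mul _).add (integrable_const _))

lemma IsProblem.integral_batchError [NeZero m] (hP : IsProblem F P L σ) (hL : 0 < L2 L P)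
    (hΔ : 0 < Δ) (ht : t = 2 * √(Δ / L2 L P)) :
    ∫ ξ, batchError L t Δ ξ ∂(Measure.pi fun _ : Fin m => P) = 4 * Δ * L2 L P := by
  have ht2 : t ^ 2 = 4 * Δ / L2 L P := by
    rw [ht, mul_pow, Real.sq_sqrt (by positivity)]
    ring
  have hLsq := hP.memLp.integrable_sq.const_mul (t ^ 2 / 2)
  refine (integral_batchMean (hLsq.add (integrable_const (8 * Δ ^ 2 / t ^ 2)))).trans ?_
  rw [integral_add' hLsq (integrable_const _), integral_const_mul, ← L2_sq, ht2]
  simp only [integral_const, probReal_univ, one_smul]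
  field_simp
  ring

lemma IsProblem.isDirectionalEstimate_batchSlope [NeZero n] [NeZero m] (hP : IsProblem F P L σ)
    (hη : Measurable (Function.uncurry η)) (hηΔ : ∀ x, ∀ᵐ ξ ∂P, |η x ξ| ≤ Δ) (ht : 0 < t)
    (x : E n) :
    IsDirectionalEstimate (Measure.pi fun _ : Fin m => P) (gradient (objective F P) x)
      (fun w => batchSlope (fun x ζ => F x ζ + η x ζ) t x w.1 w.2) (batchMean (gradNoise F P x))
      (batchError L t Δ) where
  measurable := measurable_batchSlope (hP.measurable.add hη) t measurable_const measurable_fst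
    measurable_snd
  memLp := memLp_batchMean (hP.memLp_gradNoise x)
  integral_eq_zero := by
    rw [integral_batchMean ((hP.memLp_gradNoise x).integrable one_le_two), hP.integral_gradNoise]
  integrable := hP.integrable_batchError
  norm_eq_one_and_sq_le := hP.ae_batchSlope_error_sq_le hη hηΔ ht x

lemma IsProblem.integral_norm_batchMean_gradNoise_sq_le [NeZero m] (hP : IsProblem F P L σ)
    (x : E n) :
    ∫ ξ, ‖batchMean (gradNoise F P x) ξ‖ ^ 2 ∂(Measure.pi fun _ : Fin m => P) ≤ σ ^ 2 / m := by
  rw [integral_norm_batchMean_sq (hP.memLp_gradNoise x) (hP.integral_gradNoise x)]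
  gcongr
  exact hP.integral_norm_gradNoise_sq_le x

end Step

section Iterate

variable {S W : Type*}

/-- The state after `k` steps of the recursion `s ↦ f j s w` driven by `w : Fin k → W`; it exhibits
a run of the method as a function of finitely many samples. -/
def iter (f : ℕ → S → W → S) (s₀ : S) : (k : ℕ) → (Fin k → W) → S
  | 0, _ => s₀
  | k + 1, w => f k (iter f s₀ k fun i => w i.castSucc) (w (Fin.last k))

variable [MeasurableSpace S] [MeasurableSpace W] {f : ℕ → S → W → S}

lemma measurable_iter (hf : ∀ k, Measurable fun a : S × W => f k a.1 a.2) (s₀ : S) (k : ℕ) :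
    Measurable (iter f s₀ k) := by
  induction k with
  | zero => exact measurable_const
  | succ k ih =>
    exact (hf k).comp ((ih.comp (measurable_pi_lambda _ fun i => measurable_pi_apply _)).prodMk
      (measurable_pi_apply _))

variable {ν : Measure W} [IsProbabilityMeasure ν]

lemma lintegral_iter_succ (hf : ∀ k, Measurable fun a : S × W => f k a.1 a.2) (s₀ : S) (k : ℕ)
    {Φ : S → ENNReal} (hΦ : Measurable Φ) :
    ∫⁻ w, Φ (iter f s₀ (k + 1) w) ∂(Measure.pi fun _ : Fin (k + 1) => ν) =
      ∫⁻ w, ∫⁻ v, Φ (f k (iter f s₀ k w) v) ∂ν ∂(Measure.pi fun _ : Fin k => ν) := by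
  have hmp := measurePreserving_piFinSuccAbove (fun _ : Fin (k + 1) => ν) (Fin.last k)
  let Ψ : W × (Fin k → W) → ENNReal := fun a => Φ (f k (iter f s₀ k a.2) a.1)
  have hΨ : Measurable Ψ :=
    hΦ.comp ((hf k).comp (((measurable_iter hf s₀ k).comp measurable_snd).prodMk measurable_fst))
  have hsplit (w : Fin (k + 1) → W) : Φ (iter f s₀ (k + 1) w) =
      Ψ (MeasurableEquiv.piFinSuccAbove (fun _ => W) (Fin.last k) w) := by
    simp only [Ψ, iter, MeasurableEquiv.piFinSuccAbove_apply, Fin.insertNthEquiv_symm_apply,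
      Fin.removeNth_last]
    rfl
  simp only [hsplit]
  rw [hmp.lintegral_comp hΨ, lintegral_prod_symm _ hΨ.aemeasurable]

lemma lintegral_ofReal_iter_le (hf : ∀ k, Measurable fun a : S × W => f k a.1 a.2) (s₀ : S)
    {Φ : ℕ → S → ℝ} (hΦ : ∀ k, Measurable (Φ k)) (hΦ0 : ∀ k s, 0 ≤ Φ k s) {r b : ℝ} (hr : 1 ≤ r)
    (hb : 0 ≤ b) {N : ℕ} (hstep : ∀ k < N, ∀ s,
      ∫⁻ v, ENNReal.ofReal (Φ (k + 1) (f k s v)) ∂ν ≤ ENNReal.ofReal (r * Φ k s + b)) :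
    ∫⁻ w, ENNReal.ofReal (Φ N (iter f s₀ N w)) ∂(Measure.pi fun _ : Fin N => ν) ≤
      ENNReal.ofReal (r ^ N * (Φ 0 s₀ + N * b)) := by
  have hr0 : 0 ≤ r := zero_le_one.trans hr
  induction N with
  | zero => simp [iter]
  | succ k ih =>
    rw [lintegral_iter_succ hf s₀ k (hΦ (k + 1)).ennreal_ofReal]
    calc ∫⁻ w, ∫⁻ v, ENNReal.ofReal (Φ (k + 1) (f k (iter f s₀ k w) v)) ∂ν
          ∂(Measure.pi fun _ : Fin k => ν)
        ≤ ∫⁻ w, (ENNReal.ofReal r * ENNReal.ofReal (Φ k (iter f s₀ k w)) + ENNReal.ofReal b)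
          ∂(Measure.pi fun _ : Fin k => ν) := lintegral_mono fun w => by
            rw [← ENNReal.ofReal_mul hr0, ← ENNReal.ofReal_add (mul_nonneg hr0 (hΦ0 _ _)) hb]
            exact hstep k k.lt_succ_self _
      _ = ENNReal.ofReal r * ∫⁻ w, ENNReal.ofReal (Φ k (iter f s₀ k w))
            ∂(Measure.pi fun _ : Fin k => ν) + ENNReal.ofReal b := by
          rw [lintegral_add_right _ measurable_const,
            lintegral_const_mul' _ _ ENNReal.ofReal_ne_top, lintegral_const, measure_univ, mul_one]
      _ ≤ ENNReal.ofReal r * ENNReal.ofReal (r ^ k * (Φ 0 s₀ + k * b)) +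
            ENNReal.ofReal (r ^ (k + 1) * b) := by
          gcongr
          · exact ih fun j hj => hstep j (hj.trans k.lt_succ_self)
          · exact le_mul_of_one_le_left hb (one_le_pow₀ hr)
      _ = ENNReal.ofReal (r ^ (k + 1) * (Φ 0 s₀ + ((k + 1 : ℕ) : ℝ) * b)) := by
          have := hΦ0 0 s₀
          rw [← ENNReal.ofReal_mul hr0, ← ENNReal.ofReal_add (by positivity) (by positivity)]
          push_cast
          ring_nf

end Iterate

section Potential

variable {m : ℕ} {Ξ : Type*}

lemma run_eq_iter (ft : E n → Ξ → ℝ) (d : E n → ℝ) (ℓ : ℝ) (α : ℕ → ℝ) (t : ℝ) (x₀ : E n)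
    (e : ℕ → E n) (ξ : ℕ → Fin m → Ξ) (k : ℕ) :
    ((run ft d ℓ α t x₀ e ξ k).y, (run ft d ℓ α t x₀ e ξ k).z) =
      iter (step ft d ℓ α t) (x₀, x₀) k fun i : Fin k => (e i, ξ i) := by
  induction k with
  | zero => rfl
  | succ k ih =>
    simp only [iter, Fin.val_castSucc, Fin.val_last, ← ih]
    rfl

lemma run_y_eq (ft : E n → Ξ → ℝ) (d : E n → ℝ) (ℓ : ℝ) (α : ℕ → ℝ) (t : ℝ) (x₀ : E n)
    (e : ℕ → E n) (ξ : ℕ → Fin m → Ξ) (k : ℕ) :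
    (run ft d ℓ α t x₀ e ξ k).y = (iter (step ft d ℓ α t) (x₀, x₀) k fun i => (e i, ξ i)).1 :=
  congrArg Prod.fst (run_eq_iter ft d ℓ α t x₀ e ξ k)

lemma run_calls (ft : E n → Ξ → ℝ) (d : E n → ℝ) (ℓ : ℝ) (α : ℕ → ℝ) (t : ℝ) (x₀ : E n)
    (e : ℕ → E n) (ξ : ℕ → Fin m → Ξ) (k : ℕ) : (run ft d ℓ α t x₀ e ξ k).calls = k * m := by
  induction k with
  | zero => simp [run]
  | succ k ih => simp [run, gradEst, oracleCall, ih, add_mul]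

/-- The Lyapunov function of the method after `k` iterations, in terms of the pair `s = (y, z)`;
`fs` is the optimal value and the stepsizes are `α_{k+1} = (k + 2) / c`. -/
noncomputable def potential (f d : E n → ℝ) (c fs : ℝ) (u : E n) (k : ℕ) (s : E n × E n) : ℝ :=
  (k : ℝ) * (k + 2) / (2 * c) * (f s.1 - fs) + bregman d s.2 u

lemma potential_nonneg {p : ENNReal} {f d : E n → ℝ} (hd : IsProxFunction p d) {c fs : ℝ}
    (hc : 0 ≤ c) (hfs : ∀ x, fs ≤ f x) (u : E n) (k : ℕ) (s : E n × E n) :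
    0 ≤ potential f d c fs u k s :=
  add_nonneg (mul_nonneg (by positivity) (sub_nonneg.2 (hfs _))) (bregman_nonneg hd _ _)

lemma measurable_potential {f d : E n → ℝ} (hf : Measurable f) (hd : Measurable d) (c fs : ℝ)
    (u : E n) (k : ℕ) : Measurable (potential f d c fs u k) :=
  (((hf.comp measurable_fst).sub_const fs).const_mul _).add
    ((measurable_bregman hd u).comp measurable_snd)

variable [MeasurableSpace Ξ] {P : Measure Ξ} [IsProbabilityMeasure P]
  {F : E n → Ξ → ℝ} {L : Ξ → ℝ} {σ : ℝ}

lemma IsProblem.coupling_inequality (hP : IsProblem F P L σ) {k : ℕ} {x y z u : E n} {c : ℝ}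
    (hc : 0 ≤ c) (hx : x = (2 / ((k : ℝ) + 2)) • z + (1 - 2 / ((k : ℝ) + 2)) • y) :
    ((k : ℝ) + 2) ^ 2 / (2 * c) * (objective F P x - objective F P u) -
        (k + 2) / c * inner ℝ (gradient (objective F P) x) (z - u) ≤
      k * (k + 2) / (2 * c) * (objective F P y - objective F P u) := by
  have hxu := hP.le_objective x u
  have hxy := hP.le_objective x y
  set g := gradient (objective F P) x
  have hz : z - u = ((k : ℝ) / 2) • (x - y) + (x - u) := by
    rw [hx]
    match_scalars <;> field_simp
    ring
  have hinner : (inner ℝ g (z - u) : ℝ) =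
      -(k / 2 * inner ℝ g (y - x)) - inner ℝ g (u - x) := by
    rw [hz, inner_add_right, real_inner_smul_right, ← neg_sub y x, ← neg_sub u x, inner_neg_right,
      inner_neg_right]
    ring
  have hαu := mul_le_mul_of_nonneg_left hxu (by positivity : 0 ≤ ((k : ℝ) + 2) / c)
  have hαy := mul_le_mul_of_nonneg_left hxy (by positivity : 0 ≤ (k : ℝ) * (k + 2) / (2 * c))
  rw [hinner]
  ring_nf at hαu hαy ⊢
  linarith

lemma stepSize_succ (n : ℕ) (ρ ℓ : ℝ) (k : ℕ) :
    stepSize n ρ ℓ (k + 1) = ((k : ℝ) + 2) / (96 * (n : ℝ) ^ 2 * ρ * ℓ) := by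
  rw [stepSize]
  push_cast
  ring

lemma potential_succ_le {f d : E n → ℝ} {c fs : ℝ} (hc : 0 ≤ c) (hfs : ∀ x, fs ≤ f x) (u : E n)
    (k : ℕ) (s : E n × E n) :
    potential f d c fs u (k + 1) s ≤
      ((k : ℝ) + 2) ^ 2 / (2 * c) * (f s.1 - fs) + bregman d s.2 u := by
  refine add_le_add_left (mul_le_mul_of_nonneg_right ?_ (sub_nonneg.2 (hfs _))) _
  gcongr
  push_cast
  linarith

lemma sq_stepSize_mul_integral_pNorm_sq_le (hn : 3 ≤ n) {q : ENNReal} (hq : 2 ≤ q) {ℓ : ℝ}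
    (hℓ : 0 < ℓ) (k : ℕ) :
    16 * ℓ * (stepSize n (rho n q) ℓ (k + 1) ^ 2 * n ^ 2 * ∫ e, pNorm q e ^ 2 ∂sphereLaw n) ≤
      ((k : ℝ) + 2) ^ 2 / (2 * (96 * (n : ℝ) ^ 2 * rho n q * ℓ)) := by
  have hρ := rho_pos hn hq
  calc _ ≤ 16 * ℓ * (stepSize n (rho n q) ℓ (k + 1) ^ 2 * n ^ 2 * (3 * rho n q)) := by
        gcongr
        exact integral_pNorm_sq_le_three_mul_rho hn hq
    _ = ((k : ℝ) + 2) ^ 2 / (2 * (96 * (n : ℝ) ^ 2 * rho n q * ℓ)) := by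
        rw [stepSize_succ]
        field_simp
        ring

lemma IsProblem.lintegral_potential_step_le {p q : ENNReal} {d : E n → ℝ} (hn : 3 ≤ n) [NeZero m]
    (hp : 1 ≤ p) (hp2 : p ≤ 2) (hpq : p⁻¹ + q⁻¹ = 1) (hd : IsProxFunction p d)
    (hP : IsProblem F P L σ) (hL : 0 < L2 L P) {η : E n → Ξ → ℝ}
    (hη : Measurable (Function.uncurry η)) {Δ t : ℝ} (hΔ : 0 < Δ)
    (hηΔ : ∀ x, ∀ᵐ ξ ∂P, |η x ξ| ≤ Δ) (ht : t = 2 * √(Δ / L2 L P))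
    {u : E n} (hu : ∀ x, objective F P u ≤ objective F P x) {N : ℝ} (hN : 0 < N) {c : ℝ}
    (hc : c = 96 * (n : ℝ) ^ 2 * rho n q * L2 L P) (k : ℕ) (s : E n × E n) :
    ∫⁻ w, ENNReal.ofReal (potential (objective F P) d c (objective F P u) u (k + 1)
        (step (fun x ξ => F x ξ + η x ξ) d (L2 L P) (stepSize n (rho n q) (L2 L P)) t k s w))
        ∂(sphereLaw n).prod (Measure.pi fun _ : Fin m => P) ≤
      ENNReal.ofReal ((1 + 1 / N) * potential (objective F P) d c (objective F P u) u k s +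
        ((k : ℝ) + 2) ^ 2 / (2 * c) * (σ ^ 2 / (m * n * L2 L P) + 3 * Δ +
          4 * N * n * Δ * L2 L P / c)) := by
  have : NeZero n := ⟨by omega⟩
  have hq := two_le_of_inv_add_inv_eq_one hp2 hpq
  have hρ := rho_pos hn hq
  have hc0 : 0 < c := by rw [hc]; positivity
  obtain ⟨y, z⟩ := s
  set x : E n := (2 / ((k : ℝ) + 2)) • z + (1 - 2 / ((k : ℝ) + 2)) • y with hx
  have hα : stepSize n (rho n q) (L2 L P) (k + 1) = ((k : ℝ) + 2) / c := by rw [stepSize_succ, hc]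
  obtain ⟨hint, hle⟩ := (hP.isDirectionalEstimate_batchSlope (m := m) hη hηΔ
    (ht ▸ (by positivity) : 0 < t) x).integral_potential_step_le hp hp2 hpq hd hN
    hP.differentiable_objective.continuous hu (hP.objective_le x) hL
    (hc ▸ sq_stepSize_mul_integral_pNorm_sq_le hn hq hL k) z u
  refine (lintegral_mono fun w => ENNReal.ofReal_le_ofReal
    (potential_succ_le hc0.le hu u k _)).trans ?_
  simp only [step, gradEst_fst]
  rw [← ofReal_integral_eq_lintegral_ofReal hint (.of_forall fun w => add_nonneg
    (mul_nonneg (by positivity) (sub_nonneg.2 (hu _))) (bregman_nonneg hd _ _))]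
  refine ENNReal.ofReal_le_ofReal (hle.trans ?_)
  rw [hP.integral_batchError hL hΔ ht, hα]
  have hcoupling := hP.coupling_inequality (u := u) hc0.le hx
  have hbatch : ((k : ℝ) + 2) ^ 2 / (2 * c) *
      ((∫ ξ, ‖batchMean (gradNoise F P x) ξ‖ ^ 2 ∂(Measure.pi fun _ : Fin m => P)) /
        (n * L2 L P)) ≤ ((k : ℝ) + 2) ^ 2 / (2 * c) * (σ ^ 2 / m / (n * L2 L P)) := by
    gcongr
    exact hP.integral_norm_batchMean_gradNoise_sq_le x
  have herror : (5 * (((k : ℝ) + 2) ^ 2 / (2 * c)) / (8 * L2 L P) +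
      (((k : ℝ) + 2) / c) ^ 2 * n * N / 2) * (4 * Δ * L2 L P) ≤
      ((k : ℝ) + 2) ^ 2 / (2 * c) * (3 * Δ + 4 * N * n * Δ * L2 L P / c) := by
    calc _ = ((k : ℝ) + 2) ^ 2 / (2 * c) * (5 / 2 * Δ + 4 * N * n * Δ * L2 L P / c) := by
          field_simp
          ring
      _ ≤ _ := by gcongr; norm_num
  have hgap := mul_nonneg (by positivity : 0 ≤ 1 / N * ((k : ℝ) * (k + 2) / (2 * c)))
    (sub_nonneg.2 (hu y))
  simp only [potential]
  linear_combination hcoupling + hbatch + herror + hgap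

lemma sub_le_mul_potential {p : ENNReal} {f d : E n → ℝ} (hd : IsProxFunction p d) {c fs : ℝ}
    (hc : 0 < c) (hfs : ∀ x, fs ≤ f x) (u : E n) {N : ℕ} [NeZero N] (s : E n × E n) :
    f s.1 - fs ≤ 8 * c / (3 * ((N : ℝ) + 1) ^ 2) * potential f d c fs u N s := by
  have hN : (1 : ℝ) ≤ N := by exact_mod_cast NeZero.one_le
  have hcoeff : 1 ≤ 8 * c / (3 * ((N : ℝ) + 1) ^ 2) * (N * (N + 2) / (2 * c)) := by
    rw [show 8 * c / (3 * ((N : ℝ) + 1) ^ 2) * (N * (N + 2) / (2 * c)) =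
      4 * (N * (N + 2)) / (3 * ((N : ℝ) + 1) ^ 2) by field_simp; norm_num,
      one_le_div (by positivity)]
    nlinarith
  have hgap := mul_le_mul_of_nonneg_right hcoeff (sub_nonneg.2 (hfs s.1))
  have hbregman : 0 ≤ 8 * c / (3 * ((N : ℝ) + 1) ^ 2) * bregman d s.2 u :=
    mul_nonneg (by positivity) (bregman_nonneg hd _ _)
  simp only [potential]
  linarith

lemma IsProblem.lintegral_objective_iter_le {p q : ENNReal} {d : E n → ℝ} (hn : 3 ≤ n) [NeZero m]
    (hp : 1 ≤ p) (hp2 : p ≤ 2) (hpq : p⁻¹ + q⁻¹ = 1) (hd : IsProxFunction p d)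
    (hP : IsProblem F P L σ) (hL : 0 < L2 L P) {η : E n → Ξ → ℝ}
    (hη : Measurable (Function.uncurry η)) {Δ t : ℝ} (hΔ : 0 < Δ)
    (hηΔ : ∀ x, ∀ᵐ ξ ∂P, |η x ξ| ≤ Δ) (ht : t = 2 * √(Δ / L2 L P))
    {u : E n} (hu : ∀ x, objective F P u ≤ objective F P x) {N : ℕ} [NeZero N] {c : ℝ}
    (hc : c = 96 * (n : ℝ) ^ 2 * rho n q * L2 L P) (x₀ : E n) :
    ∫⁻ w, ENNReal.ofReal (objective F P (iter (step (fun x ξ => F x ξ + η x ξ) d (L2 L P)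
        (stepSize n (rho n q) (L2 L P)) t) (x₀, x₀) N w).1 - objective F P u)
        ∂(sampleLaw n N m P) ≤
      ENNReal.ofReal (8 * c * bregman d x₀ u / ((N : ℝ) + 1) ^ 2 +
        4 * N * (σ ^ 2 / (m * n * L2 L P) + 3 * Δ + 4 * N * n * Δ * L2 L P / c)) := by
  have : NeZero n := ⟨by omega⟩
  have hN0 : (0 : ℝ) < N := by exact_mod_cast NeZero.pos N
  have hρ := rho_pos hn (two_le_of_inv_add_inv_eq_one hp2 hpq)
  have hc0 : 0 < c := by rw [hc]; positivity
  have hΘ := bregman_nonneg hd x₀ u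
  set D : ℝ := σ ^ 2 / (m * n * L2 L P) + 3 * Δ + 4 * N * n * Δ * L2 L P / c
  set b : ℝ := ((N : ℝ) + 1) ^ 2 / (2 * c) * D with hb
  have hpot := lintegral_ofReal_iter_le (b := b) (N := N)
    (fun k => measurable_step (m := m) (hP.measurable.add hη) hp hp2 hd (L2 L P)
      (stepSize n (rho n q) (L2 L P)) t k) (x₀, x₀)
    (measurable_potential hP.differentiable_objective.continuous.measurable
      hd.differentiable.continuous.measurable c (objective F P u) u)
    (potential_nonneg hd hc0.le hu u) (le_add_of_nonneg_right (by positivity : 0 ≤ 1 / (N : ℝ)))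
    (by positivity) fun k hk s => by
      refine (hP.lintegral_potential_step_le hn hp hp2 hpq hd hL hη hΔ hηΔ ht hu hN0 hc k
        s).trans (ENNReal.ofReal_le_ofReal (add_le_add_right ?_ _))
      have hkN : (k : ℝ) + 1 ≤ N := by exact_mod_cast hk
      change _ * D ≤ ((N : ℝ) + 1) ^ 2 / (2 * c) * D
      gcongr ?_ ^ 2 / _ * _
      linarith
  refine (lintegral_mono fun w => ENNReal.ofReal_le_ofReal
    (sub_le_mul_potential hd hc0 hu u (N := N) _)).trans ?_
  simp only [ENNReal.ofReal_mul (by positivity : 0 ≤ 8 * c / (3 * ((N : ℝ) + 1) ^ 2))]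
  rw [lintegral_const_mul' _ _ ENNReal.ofReal_ne_top]
  refine (mul_le_mul_right hpot _).trans ?_
  rw [← ENNReal.ofReal_mul (by positivity)]
  refine ENNReal.ofReal_le_ofReal ?_
  calc _ ≤ 8 * c / (3 * ((N : ℝ) + 1) ^ 2) * (3 * (bregman d x₀ u + N * b)) := by
        rw [show potential (objective F P) d c (objective F P u) u 0 (x₀, x₀) = bregman d x₀ u by
          simp [potential]]
        gcongr
        rw [one_div]
        exact Real.one_add_inv_pow_le_exp.trans Real.exp_one_lt_three.le
    _ = _ := by
        rw [hb]
        field_simp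
        ring

end Potential

section ParameterSizes

variable {ν ρ ℓ Θ ε σ Δ t a b Y : ℝ}

lemma rpow_three_halves (hε : 0 < ε) : ε ^ (3 / 2 : ℝ) = ε * √ε := by
  rw [show (3 / 2 : ℝ) = 1 + 1 / 2 by norm_num, Real.rpow_add hε, Real.rpow_one,
    ← Real.sqrt_eq_rpow]

lemma batch_ratio_eq (hν : 0 < ν) (hρ : 0 < ρ) (hℓ : 0 < ℓ) (hΘ : 0 ≤ Θ) (hε : 0 < ε) :
    σ ^ 2 / ε ^ (3 / 2 : ℝ) * √(ρ * Θ / ℓ) =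
      σ ^ 2 * √(ν ^ 2 * ρ * ℓ * Θ / ε) / (ε * ν * ℓ) := by
  have hsplit : √(ν ^ 2 * ρ * ℓ * Θ / ε) = ν * ℓ * √(ρ * Θ / ℓ) / √ε := by
    rw [Real.sqrt_div (by positivity), show ν ^ 2 * ρ * ℓ * Θ = (ν * ℓ) ^ 2 * (ρ * Θ / ℓ) by
      field_simp, Real.sqrt_mul (by positivity), Real.sqrt_sq (by positivity)]
  rw [hsplit, rpow_three_halves hε]
  field_simp

lemma sqrt_mul_batch_ratio_eq (hν : 0 < ν) (hρ : 0 < ρ) (hℓ : 0 < ℓ) (hΘ : 0 ≤ Θ) (hε : 0 < ε) :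
    √(ν ^ 2 * ρ * ℓ * Θ / ε) * (σ ^ 2 / ε ^ (3 / 2 : ℝ) * √(ρ * Θ / ℓ)) =
      ν * ρ * σ ^ 2 * Θ / ε ^ 2 := by
  rw [batch_ratio_eq hν hρ hℓ hΘ hε]
  have hsq : √(ν ^ 2 * ρ * ℓ * Θ / ε) * √(ν ^ 2 * ρ * ℓ * Θ / ε) = ν ^ 2 * ρ * ℓ * Θ / ε :=
    Real.mul_self_sqrt (by positivity)
  calc _ = σ ^ 2 * (√(ν ^ 2 * ρ * ℓ * Θ / ε) * √(ν ^ 2 * ρ * ℓ * Θ / ε)) / (ε * ν * ℓ) := by ring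
    _ = _ := by
      rw [hsq]
      field_simp

lemma convergence_bound_le (hν : 0 < ν) (hρ : 0 < ρ) (hℓ : 0 < ℓ) (hΘ : 0 ≤ Θ) (hε : 0 < ε)
    (hΔ : 0 ≤ Δ) {N m : ℕ} [NeZero m] (hN : N = ⌊40 * √(ν ^ 2 * ρ * ℓ * Θ / ε)⌋₊)
    (hm : m = ⌈1000 * max 1 (σ ^ 2 / ε ^ (3 / 2 : ℝ) * √(ρ * Θ / ℓ))⌉₊)
    (hΔ₁ : Δ * (ν * ℓ * Θ) ≤ 1 / 5000 * ε ^ 2)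
    (hΔ₂ : Δ * √(ν ^ 2 * ρ * ℓ * Θ) ≤ 1 / 5000 * ε ^ (3 / 2 : ℝ)) :
    8 * (96 * ν ^ 2 * ρ * ℓ) * Θ / ((N : ℝ) + 1) ^ 2 +
        4 * N * (σ ^ 2 / (m * ν * ℓ) + 3 * Δ + 4 * N * ν * Δ * ℓ / (96 * ν ^ 2 * ρ * ℓ)) ≤ ε := by
  have hm0 : (0 : ℝ) < m := by exact_mod_cast NeZero.pos m
  have hε' : 0 < √ε := Real.sqrt_pos.2 hε
  have hXε : √(ν ^ 2 * ρ * ℓ * Θ) = √(ν ^ 2 * ρ * ℓ * Θ / ε) * √ε := by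
    rw [← Real.sqrt_mul (by positivity), div_mul_cancel₀ _ hε.ne']
  have hratio : 1000 * (σ ^ 2 / ε ^ (3 / 2 : ℝ) * √(ρ * Θ / ℓ)) ≤ m := by
    grw [hm, ← Nat.le_ceil, ← le_max_right]
  rw [batch_ratio_eq hν hρ hℓ hΘ hε] at hratio
  rw [rpow_three_halves hε, hXε, ← mul_assoc, ← mul_assoc] at hΔ₂
  set X := √(ν ^ 2 * ρ * ℓ * Θ / ε)
  have hX : X ^ 2 * ε = ν ^ 2 * ρ * ℓ * Θ := by
    rw [Real.sq_sqrt (by positivity), div_mul_cancel₀ _ hε.ne']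
  have hNX : N ≤ 40 * X := hN ▸ Nat.floor_le (by positivity)
  have hXN : 40 * X ≤ N + 1 := hN ▸ (Nat.lt_floor_add_one _).le
  have hinitial : 8 * (96 * ν ^ 2 * ρ * ℓ) * Θ / ((N : ℝ) + 1) ^ 2 ≤ 48 / 100 * ε := by
    rw [div_le_iff₀ (by positivity)]
    calc _ = 48 / 100 * ε * (40 * X) ^ 2 := by linear_combination (-768) * hX
      _ ≤ _ := by gcongr
  have hvariance : N * (σ ^ 2 / (m * ν * ℓ)) ≤ 40 / 1000 * ε := by
    rw [mul_div_assoc', div_le_iff₀ (by positivity)]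
    calc N * σ ^ 2 ≤ 40 * X * σ ^ 2 := by gcongr
      _ = 40 / 1000 * ε * (1000 * (σ ^ 2 * X / (ε * ν * ℓ)) * ν * ℓ) := by field_simp
      _ ≤ _ := by gcongr
  have hbias : N * Δ ≤ 40 / 5000 * ε := by
    have hXΔ : Δ * X ≤ 1 / 5000 * ε := le_of_mul_le_mul_right hΔ₂ hε'
    calc N * Δ ≤ 40 * X * Δ := by gcongr
      _ ≤ 40 / 5000 * ε := by linarith
  have hdrift : N * (4 * N * ν * Δ * ℓ / (96 * ν ^ 2 * ρ * ℓ)) ≤ 4 * 1600 / 96 / 5000 * ε := by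
    rw [mul_div_assoc', div_le_iff₀ (by positivity)]
    refine le_of_mul_le_mul_right ?_ hε
    calc N * (4 * N * ν * Δ * ℓ) * ε = 4 * ν * Δ * ℓ * ε * N ^ 2 := by ring
      _ ≤ 4 * ν * Δ * ℓ * ε * (40 * X) ^ 2 := by gcongr
      _ = 4 * 1600 * ν ^ 2 * ρ * ℓ * (Δ * (ν * ℓ * Θ)) := by
          linear_combination 6400 * ν * Δ * ℓ * hX
      _ ≤ 4 * 1600 * ν ^ 2 * ρ * ℓ * (1 / 5000 * ε ^ 2) := by gcongr
      _ = _ := by ring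
  linarith

lemma natCeil_mul_max_one_le (hb : 0 ≤ b) : (⌈b * max 1 Y⌉₊ : ℝ) ≤ (b + 1) * max 1 Y := by
  have hceil := Nat.ceil_lt_add_one (show 0 ≤ b * max 1 Y by positivity)
  linarith [le_max_left 1 Y]

lemma iterations_mul_batch_le (hν : 0 < ν) (hρ : 0 < ρ) (hℓ : 0 < ℓ) (hΘ : 0 ≤ Θ) (hε : 0 < ε)
    (ha : 0 ≤ a) (hb : 0 ≤ b) :
    (⌊a * √(ν ^ 2 * ρ * ℓ * Θ / ε)⌋₊ * ⌈b * max 1 (σ ^ 2 / ε ^ (3 / 2 : ℝ) * √(ρ * Θ / ℓ))⌉₊ : ℝ) ≤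
      a * (b + 1) * max √(ν ^ 2 * ρ * ℓ * Θ / ε) (ν * ρ * σ ^ 2 * Θ / ε ^ 2) := by
  rw [← sqrt_mul_batch_ratio_eq hν hρ hℓ hΘ hε]
  set X := √(ν ^ 2 * ρ * ℓ * Θ / ε)
  set Y := σ ^ 2 / ε ^ (3 / 2 : ℝ) * √(ρ * Θ / ℓ)
  have hX : 0 ≤ X := Real.sqrt_nonneg _
  calc _ ≤ a * X * ((b + 1) * max 1 Y) := by
        gcongr
        · exact Nat.floor_le (by positivity)
        · exact natCeil_mul_max_one_le hb
    _ = a * (b + 1) * (X * max 1 Y) := by ring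
    _ = a * (b + 1) * max X (X * Y) := by rw [mul_max_of_nonneg _ _ hX, mul_one]

lemma smoothing_mul_sqrt_le (hν : 0 ≤ ν) (hℓ : 0 < ℓ) (hΘ : 0 ≤ Θ) (hε : 0 ≤ ε) (hΔ : 0 ≤ Δ)
    (h : Δ * (ν * ℓ * Θ) ≤ ε ^ 2) : 2 * √(Δ / ℓ) * (ℓ * √(ν * Θ)) ≤ 2 * ε := by
  rw [mul_assoc]
  gcongr
  refine le_of_sq_le_sq ?_ hε
  calc (√(Δ / ℓ) * (ℓ * √(ν * Θ))) ^ 2 = Δ * (ν * ℓ * Θ) := by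
        rw [mul_pow, mul_pow, Real.sq_sqrt (by positivity), Real.sq_sqrt (by positivity)]
        field_simp
    _ ≤ ε ^ 2 := h

lemma smoothing_mul_rpow_le (hρ : 0 ≤ ρ) (hℓ : 0 < ℓ) (hΘ : 0 ≤ Θ) (hε : 0 ≤ ε) (hΔ : 0 ≤ Δ)
    (h : Δ * √(ν ^ 2 * ρ * ℓ * Θ) ≤ ε ^ (3 / 2 : ℝ)) :
    2 * √(Δ / ℓ) * (ν ^ 2 * ρ * ℓ ^ 3 * Θ) ^ (1 / 4 : ℝ) ≤ 2 * ε ^ (3 / 4 : ℝ) := by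
  have hfactor : ν ^ 2 * ρ * ℓ ^ 3 * Θ = ℓ ^ 2 * (ν ^ 2 * ρ * ℓ * Θ) := by ring
  have hroot : (ν ^ 2 * ρ * ℓ ^ 3 * Θ) ^ (1 / 4 : ℝ) = √(ℓ * √(ν ^ 2 * ρ * ℓ * Θ)) := by
    rw [show (1 / 4 : ℝ) = 1 / 2 * (1 / 2) by norm_num, Real.rpow_mul (by positivity),
      ← Real.sqrt_eq_rpow, ← Real.sqrt_eq_rpow, hfactor, Real.sqrt_mul (by positivity),
      Real.sqrt_sq hℓ.le]
  calc _ = 2 * √(Δ * √(ν ^ 2 * ρ * ℓ * Θ)) := by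
        rw [hroot, mul_assoc, ← Real.sqrt_mul (by positivity), ← mul_assoc,
          div_mul_cancel₀ _ hℓ.ne']
    _ ≤ 2 * √(ε ^ (3 / 2 : ℝ)) := by gcongr
    _ = 2 * ε ^ (3 / 4 : ℝ) := by
        rw [Real.sqrt_eq_rpow, ← Real.rpow_mul hε]
        norm_num

lemma max_le_sq_mul_max {θ R b : ℝ} (hν : 0 < ν) (hℓ : 0 < ℓ) (hε : 0 < ε) (hb : 1 ≤ b)
    (h : ν * ρ * Θ ≤ b * (ν ^ (2 * θ) * R ^ 2)) :
    max √(ν ^ 2 * ρ * ℓ * Θ / ε) (ν * ρ * σ ^ 2 * Θ / ε ^ 2) ≤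
      b * max (ν ^ (1 / 2 + θ) * √(ℓ * R ^ 2 / ε)) (ν ^ (2 * θ) * σ ^ 2 * R ^ 2 / ε ^ 2) := by
  rw [mul_max_of_nonneg _ _ (by positivity)]
  refine max_le_max ?_ ?_
  · have hpow : (ν ^ (1 / 2 + θ)) ^ 2 = ν * ν ^ (2 * θ) := by
      rw [← Real.rpow_mul_natCast hν.le, show (1 / 2 + θ) * (2 : ℕ) = 1 + 2 * θ by push_cast; ring,
        Real.rpow_add hν, Real.rpow_one]
    refine Real.sqrt_le_iff.2 ⟨by positivity, ?_⟩
    calc ν ^ 2 * ρ * ℓ * Θ / ε = ν * ℓ / ε * (ν * ρ * Θ) := by ring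
      _ ≤ ν * ℓ / ε * (b * (ν ^ (2 * θ) * R ^ 2)) := by gcongr
      _ = b * (ν * ν ^ (2 * θ) * (ℓ * R ^ 2 / ε)) := by ring
      _ ≤ b ^ 2 * (ν * ν ^ (2 * θ) * (ℓ * R ^ 2 / ε)) := by
          gcongr
          exact le_self_pow₀ hb two_ne_zero
      _ = _ := by rw [mul_pow, mul_pow _ √_, hpow, Real.sq_sqrt (by positivity)]
  · calc ν * ρ * σ ^ 2 * Θ / ε ^ 2 = σ ^ 2 / ε ^ 2 * (ν * ρ * Θ) := by ring
      _ ≤ σ ^ 2 / ε ^ 2 * (b * (ν ^ (2 * θ) * R ^ 2)) := by gcongr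
      _ = _ := by ring

end ParameterSizes

section ProxSize

lemma bregman_proxTwo (x z : E n) : bregman (proxTwo n) z x = 1 / 2 * ‖x - z‖ ^ 2 := by
  rw [bregman, gradient_proxTwo, proxTwo, proxTwo, norm_sub_sq_real, inner_sub_right,
    real_inner_self_eq_norm_sq, real_inner_comm]
  ring

lemma proxOne_nonneg (c x : E n) : 0 ≤ proxOne n c x := by
  unfold proxOne
  positivity

lemma bregman_proxOne_self (hn : 3 ≤ n) (x₀ x : E n) :
    bregman (proxOne n x₀) x₀ x = proxOne n x₀ x := by
  have hκ := ENNReal.one_le_ofReal.2 (one_lt_kappa hn).le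
  have hzero : proxOne n x₀ x₀ = 0 := by
    have := pNorm_smul hκ 0 (0 : E n)
    simp_all [proxOne]
  have hgrad : gradient (proxOne n x₀) x₀ = 0 :=
    gradient_eq_of_isMinOn_sub_inner ((isProxFunction_proxOne hn x₀).differentiable x₀) fun y => by
      simpa [hzero] using proxOne_nonneg x₀ y
  rw [bregman, hgrad, inner_zero_left, hzero, sub_zero, sub_zero]

lemma proxOne_le (hn : 3 ≤ n) (x₀ x : E n) :
    proxOne n x₀ x ≤ 4 * Real.log n * pNorm 1 (x₀ - x) ^ 2 := by
  have hκ := ENNReal.one_le_ofReal.2 (one_lt_kappa hn).le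
  have hκ₁ := one_lt_kappa hn
  have hlog := one_lt_log hn
  have hpow : (n : ℝ) ^ ((kappa n - 1) * (2 - kappa n) / kappa n) ≤ Real.exp 1 := by
    rw [← rpow_kappa_sub_one hn]
    refine Real.rpow_le_rpow_of_exponent_le (by exact_mod_cast (by omega : 1 ≤ n)) ?_
    rw [div_le_iff₀ (by linarith)]
    gcongr
    linarith
  have hrev : pNorm 1 (x₀ - x) = pNorm 1 (x - x₀) := by
    simpa using pNorm_smul le_rfl (-1) (x - x₀)
  have he : Real.exp 1 * Real.exp 1 ≤ 8 := by
    nlinarith [Real.exp_one_lt_d9, Real.exp_pos 1]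
  rw [hrev, proxOne]
  calc _ ≤ Real.exp 1 * Real.exp 1 * Real.log n / 2 * pNorm 1 (x - x₀) ^ 2 := by
        gcongr
        · exact pNorm_nonneg hκ _
        · exact pNorm_anti le_rfl hκ _
    _ ≤ 8 * Real.log n / 2 * pNorm 1 (x - x₀) ^ 2 := by gcongr
    _ = _ := by ring

lemma mul_rho_top (hn : 3 ≤ n) : n * rho n ⊤ = 16 * Real.log n - 8 := by
  have hlog := one_lt_log hn
  have hn0 : (n : ℝ) ≠ 0 := by positivity
  rw [rho, ENNReal.top_sub ENNReal.one_ne_top, min_eq_right le_top,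
    ENNReal.toReal_ofReal (by linarith)]
  simp only [ENNReal.inv_top, ENNReal.toReal_zero, mul_zero, zero_sub, Real.rpow_neg_one]
  field_simp

lemma rho_two (hn : 3 ≤ n) : rho n 2 = 1 := by
  have hlog := one_lt_log hn
  have hmin : min ((2 : ENNReal) - 1) (ENNReal.ofReal (16 * Real.log n - 8)) = 1 := by
    rw [← one_add_one_eq_two, ENNReal.add_sub_cancel_right ENNReal.one_ne_top]
    exact min_eq_left (ENNReal.one_le_ofReal.2 (by linarith))
  simp [rho, hmin]

lemma mul_rho_mul_bregman_le (hn : 3 ≤ n) {p q : ENNReal} (hpq : p⁻¹ + q⁻¹ = 1) {d : E n → ℝ}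
    {x₀ u : E n} (h : (p = 1 ∧ d = proxOne n x₀) ∨ (p = 2 ∧ d = proxTwo n)) :
    n * rho n q * bregman d x₀ u ≤
      64 * Real.log n ^ 2 * ((n : ℝ) ^ (2 * (q⁻¹).toReal) * pNorm p (x₀ - u) ^ 2) := by
  have hlog := one_lt_log hn
  rcases h with ⟨rfl, rfl⟩ | ⟨rfl, rfl⟩
  · obtain rfl : q = ⊤ := ENNReal.inv_eq_zero.1
      ((ENNReal.add_right_inj ENNReal.one_ne_top).1 (by simpa using hpq))
    rw [mul_rho_top hn, bregman_proxOne_self hn]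
    calc _ ≤ 16 * Real.log n * (4 * Real.log n * pNorm 1 (x₀ - u) ^ 2) := by
          gcongr
          · exact proxOne_nonneg x₀ u
          · linarith
          · exact proxOne_le hn x₀ u
      _ = _ := by
        simp only [ENNReal.inv_top, ENNReal.toReal_zero, mul_zero, Real.rpow_zero]
        ring
  · obtain rfl : q = 2 := inv_injective
      ((ENNReal.add_right_inj (by simp)).1 (hpq.trans ENNReal.inv_two_add_inv_two.symm))
    rw [rho_two hn, bregman_proxTwo, pNorm_two, norm_sub_rev]
    calc _ = 1 / 2 * (n * ‖x₀ - u‖ ^ 2) := by ring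
      _ ≤ 64 * Real.log n ^ 2 * (n * ‖x₀ - u‖ ^ 2) := by
        gcongr
        nlinarith
      _ = _ := by simp

end ProxSize

section Convergence

lemma integrable_and_integral_sub_le {Ω : Type*} [MeasurableSpace Ω] {μ : Measure Ω}
    [IsProbabilityMeasure μ] {Z : Ω → ℝ} {a ε : ℝ} (hZ : AEStronglyMeasurable Z μ)
    (ha : ∀ ω, a ≤ Z ω) (hε : 0 ≤ ε)
    (h : ∫⁻ ω, ENNReal.ofReal (Z ω - a) ∂μ ≤ ENNReal.ofReal ε) :
    Integrable Z μ ∧ (∫ ω, Z ω ∂μ) - a ≤ ε := by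
  have hnonneg : ∀ᵐ ω ∂μ, 0 ≤ Z ω - a := .of_forall fun ω => sub_nonneg.2 (ha ω)
  have hsub : Integrable (fun ω => Z ω - a) μ :=
    ⟨hZ.sub aestronglyMeasurable_const,
      (hasFiniteIntegral_iff_ofReal hnonneg).2 (h.trans_lt ENNReal.ofReal_lt_top)⟩
  have hint : Integrable Z μ :=
    (hsub.add (integrable_const a)).congr (.of_forall fun ω => sub_add_cancel (Z ω) a)
  refine ⟨hint, ?_⟩
  rw [← ENNReal.ofReal_le_ofReal_iff hε]
  calc ENNReal.ofReal ((∫ ω, Z ω ∂μ) - a) = ENNReal.ofReal (∫ ω, (Z ω - a) ∂μ) := by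
        simp [integral_sub hint]
    _ ≤ ENNReal.ofReal ε := by rwa [ofReal_integral_eq_lintegral_ofReal hsub hnonneg]

variable {m : ℕ} {Ξ : Type*} [MeasurableSpace Ξ] {P : Measure Ξ} [IsProbabilityMeasure P]
  {F : E n → Ξ → ℝ} {L : Ξ → ℝ} {σ : ℝ} {p q : ENNReal} {d : E n → ℝ}

lemma IsProblem.objective_sub_le_mul_bregman (hP : IsProblem F P L σ) (hp : 1 ≤ p) (hp2 : p ≤ 2)
    (hd : IsProxFunction p d) {u : E n} (hu : ∀ x, objective F P u ≤ objective F P x) (x : E n) :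
    objective F P x - objective F P u ≤ L2 L P * bregman d x u := by
  have hgrad : gradient (objective F P) u = 0 :=
    gradient_eq_of_isMinOn_sub_inner (hP.differentiable_objective u) fun v => by simpa using hu v
  have hsmooth := hP.objective_le u x
  rw [hgrad, inner_zero_left, norm_sub_rev] at hsmooth
  have hprox := half_norm_sq_le_bregman hp hp2 hd x u
  calc objective F P x - objective F P u ≤ L2 L P * (1 / 2 * ‖u - x‖ ^ 2) := by linarith
    _ ≤ L2 L P * bregman d x u := by
        gcongr
        exact Real.sqrt_nonneg _

lemma IsProblem.objective_sub_le_of_sqrt_le_one (hn : 3 ≤ n) (hp : 1 ≤ p) (hp2 : p ≤ 2)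
    (hpq : p⁻¹ + q⁻¹ = 1) (hd : IsProxFunction p d) (hP : IsProblem F P L σ)
    {u x₀ : E n} (hu : ∀ x, objective F P u ≤ objective F P x) {ε : ℝ} (hε : 0 < ε)
    (h : √((n : ℝ) ^ 2 * rho n q * L2 L P * bregman d x₀ u / ε) ≤ 1) :
    objective F P x₀ - objective F P u ≤ ε := by
  have hρ := one_le_mul_rho hn (two_le_of_inv_add_inv_eq_one hp2 hpq)
  have hn1 : (1 : ℝ) ≤ n := by exact_mod_cast (by omega : 1 ≤ n)
  have hLΘ : 0 ≤ L2 L P * bregman d x₀ u := mul_nonneg (Real.sqrt_nonneg _) (bregman_nonneg hd _ _)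
  calc objective F P x₀ - objective F P u ≤ 1 * (L2 L P * bregman d x₀ u) := by
        simpa using hP.objective_sub_le_mul_bregman hp hp2 hd hu x₀
    _ ≤ n * (n * rho n q) * (L2 L P * bregman d x₀ u) := by
        gcongr
        exact one_le_mul_of_one_le_of_one_le hn1 hρ
    _ = (n : ℝ) ^ 2 * rho n q * L2 L P * bregman d x₀ u := by ring
    _ ≤ ε := by simpa [div_le_one hε] using (Real.sqrt_le_iff.1 h).2

variable {η : E n → Ξ → ℝ} {Δ t ε : ℝ} {u x₀ : E n} {N : ℕ} {Ω : Type*} [MeasurableSpace Ω]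
  {Pr : Measure Ω} [IsProbabilityMeasure Pr] {e : ℕ → Ω → E n} {ξ : ℕ → Fin m → Ω → Ξ}

lemma IsProblem.integrable_and_integral_run_sub_le_of_lintegral_iter_le (hp : 1 ≤ p) (hp2 : p ≤ 2)
    (hd : IsProxFunction p d) (hP : IsProblem F P L σ) (hη : Measurable (Function.uncurry η))
    (hu : ∀ x, objective F P u ≤ objective F P x) (hε : 0 ≤ ε) {ℓ : ℝ} {α : ℕ → ℝ}
    (hlaw : HasLaw (fun ω (k : Fin N) => (e k ω, fun i => ξ k i ω)) (sampleLaw n N m P) Pr)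
    (hle : ∫⁻ w, ENNReal.ofReal (objective F P (iter (step (fun x ζ => F x ζ + η x ζ) d ℓ α t)
        (x₀, x₀) N w).1 - objective F P u) ∂(sampleLaw n N m P) ≤ ENNReal.ofReal ε) :
    Integrable (fun ω => objective F P (run (fun x ζ => F x ζ + η x ζ) d ℓ α t x₀
        (fun k => e k ω) (fun k i => ξ k i ω) N).y) Pr ∧
      (∫ ω, objective F P (run (fun x ζ => F x ζ + η x ζ) d ℓ α t x₀
        (fun k => e k ω) (fun k i => ξ k i ω) N).y ∂Pr) - objective F P u ≤ ε := by
  have hmeas : Measurable fun w => objective F P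
      (iter (step (m := m) (fun x ζ => F x ζ + η x ζ) d ℓ α t) (x₀, x₀) N w).1 :=
    hP.differentiable_objective.continuous.measurable.comp (measurable_fst.comp (measurable_iter
      (fun k => measurable_step (hP.measurable.add hη) hp hp2 hd ℓ α t k) _ N))
  rw [← hlaw.lintegral_comp (hmeas.sub_const _).ennreal_ofReal.aemeasurable] at hle
  simp only [run_y_eq]
  exact integrable_and_integral_sub_le
    (hmeas.comp_aemeasurable hlaw.aemeasurable).aestronglyMeasurable (fun ω => hu _) hε hle

lemma IsProblem.integrable_and_integral_run_sub_le (hn : 3 ≤ n) (hp : 1 ≤ p) (hp2 : p ≤ 2)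
    (hpq : p⁻¹ + q⁻¹ = 1) (hd : IsProxFunction p d) (hP : IsProblem F P L σ)
    (hL : 0 < L2 L P) (hη : Measurable (Function.uncurry η)) (hΔ : 0 < Δ)
    (hηΔ : ∀ x, ∀ᵐ ξ ∂P, |η x ξ| ≤ Δ) (hu : ∀ x, objective F P u ≤ objective F P x) (hε : 0 < ε)
    (hN : N = ⌊40 * √((n : ℝ) ^ 2 * rho n q * L2 L P * bregman d x₀ u / ε)⌋₊)
    (hm : m = ⌈1000 * max 1 (σ ^ 2 / ε ^ (3 / 2 : ℝ) * √(rho n q * bregman d x₀ u / L2 L P))⌉₊)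
    (hΔ₁ : Δ * (n * L2 L P * bregman d x₀ u) ≤ 1 / 5000 * ε ^ 2)
    (hΔ₂ : Δ * √((n : ℝ) ^ 2 * rho n q * L2 L P * bregman d x₀ u) ≤ 1 / 5000 * ε ^ (3 / 2 : ℝ))
    (ht : t = 2 * √(Δ / L2 L P))
    (hlaw : HasLaw (fun ω (k : Fin N) => (e k ω, fun i => ξ k i ω)) (sampleLaw n N m P) Pr) :
    Integrable (fun ω => objective F P (run (fun x ζ => F x ζ + η x ζ) d (L2 L P)
        (stepSize n (rho n q) (L2 L P)) t x₀ (fun k => e k ω) (fun k i => ξ k i ω) N).y) Pr ∧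
      (∫ ω, objective F P (run (fun x ζ => F x ζ + η x ζ) d (L2 L P)
        (stepSize n (rho n q) (L2 L P)) t x₀ (fun k => e k ω) (fun k i => ξ k i ω) N).y ∂Pr) -
          objective F P u ≤ ε := by
  rcases N.eq_zero_or_pos with rfl | hNpos
  · have hsmall := Nat.floor_eq_zero.1 hN.symm
    have hx₀ := hP.objective_sub_le_of_sqrt_le_one hn hp hp2 hpq hd hu (x₀ := x₀) hε (by
      linarith [Real.sqrt_nonneg ((n : ℝ) ^ 2 * rho n q * L2 L P * bregman d x₀ u / ε)])
    simpa [run] using hx₀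
  · have : NeZero N := ⟨hNpos.ne'⟩
    have : NeZero m := ⟨hm ▸ (Nat.ceil_pos.2 (by positivity)).ne'⟩
    have hρ := rho_pos hn (two_le_of_inv_add_inv_eq_one hp2 hpq)
    have hbound := convergence_bound_le (by positivity) hρ hL (bregman_nonneg hd x₀ u) hε hΔ.le
      hN hm hΔ₁ hΔ₂
    exact hP.integrable_and_integral_run_sub_le_of_lintegral_iter_le hp hp2 hd hη hu hε.le hlaw
      ((hP.lintegral_objective_iter_le hn hp hp2 hpq hd hL hη hΔ hηΔ ht hu rfl x₀).trans
        (ENNReal.ofReal_le_ofReal hbound))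

end Convergence

end ARDFDS

theorem corollary1 :
    (∃ A B c K : ℝ, 0 < A ∧ 0 < B ∧ 0 < c ∧ 0 < K ∧
      ∀ (n : ℕ) (_ : 8 ≤ n)
        -- proximal setup
        (p q : ENNReal) (_ : 1 ≤ p) (_ : p ≤ 2) (_ : p⁻¹ + q⁻¹ = 1)
        (d : E n → ℝ) (_ : IsProxFunction p d)
        -- problem
        (Ξ : Type*) [MeasurableSpace Ξ] (P : Measure Ξ) [IsProbabilityMeasure P]
        (F : E n → Ξ → ℝ) (L : Ξ → ℝ) (σ : ℝ) (_ : IsProblem F P L σ) (_ : 0 < L2 L P)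
        (xs : E n) (_ : ∀ x, objective F P xs ≤ objective F P x)
        -- target accuracy, starting point
        (ε : ℝ) (_ : 0 < ε) (x₀ : E n)
        (ρ ℓ Θ : ℝ) (_ : ρ = rho n q) (_ : ℓ = L2 L P) (_ : Θ = bregman d x₀ xs)
        -- number of iterations and batch size
        (N m : ℕ) (_ : N = ⌊A * √((n : ℝ) ^ 2 * ρ * ℓ * Θ / ε)⌋₊)
        (_ : m = ⌈B * max 1 (σ ^ 2 / ε ^ (3 / 2 : ℝ) * √(ρ * Θ / ℓ))⌉₊)
        -- noise level `Δ ≤ c * min {ε² / (n L₂ Θ), ε^(3/2) / √(n² ρ L₂ Θ)}`, with the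
        -- denominators cleared so that the case `Θ = 0` is covered, and smoothing parameter
        (Δ t : ℝ) (_ : 0 < Δ) (_ : Δ * (n * ℓ * Θ) ≤ c * ε ^ 2)
        (_ : Δ * √((n : ℝ) ^ 2 * ρ * ℓ * Θ) ≤ c * ε ^ (3 / 2 : ℝ))
        (_ : t = 2 * √(Δ / ℓ))
        -- noise
        (η : E n → Ξ → ℝ) (_ : Measurable (Function.uncurry η))
        (_ : ∀ x, ∀ᵐ ξ ∂P, |η x ξ| ≤ Δ)
        -- random directions and batches
        (Ω : Type*) [MeasurableSpace Ω] (Pr : Measure Ω) [IsProbabilityMeasure Pr]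
        (e : ℕ → Ω → E n) (ξ : ℕ → Fin m → Ω → Ξ)
        (_ : HasLaw (fun ω (k : Fin N) => (e k ω, fun i => ξ k i ω)) (sampleLaw n N m P) Pr)
        (S : Ω → State n)
        (_ : ∀ ω, S ω = run (fun x w => F x w + η x w) d ℓ (stepSize n ρ ℓ) t x₀
          (fun k => e k ω) (fun k i => ξ k i ω) N),
        -- convergence
        (Integrable (fun ω => objective F P (S ω).y) Pr ∧
          (∫ ω, objective F P (S ω).y ∂Pr) - objective F P xs ≤ ε) ∧
        -- orders of the parameters
        (N : ℝ) ≤ K * √((n : ℝ) ^ 2 * ρ * ℓ * Θ / ε) ∧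
        1 ≤ m ∧ (m : ℝ) ≤ K * max 1 (σ ^ 2 / ε ^ (3 / 2 : ℝ) * √(ρ * Θ / ℓ)) ∧
        t * (ℓ * √(n * Θ)) ≤ K * ε ∧
        t * ((n : ℝ) ^ 2 * ρ * ℓ ^ 3 * Θ) ^ (1 / 4 : ℝ) ≤ K * ε ^ (3 / 4 : ℝ) ∧
        -- number of oracle calls
        (∀ ω, (S ω).calls = N * m ∧
          ((S ω).calls : ℝ) ≤
            K * max √((n : ℝ) ^ 2 * ρ * ℓ * Θ / ε) (n * ρ * σ ^ 2 * Θ / ε ^ 2)) ∧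
        -- the same in terms of the distance `R_p = ‖x₀ - x*‖_p`, up to powers of `ln n`
        ((p = 1 ∧ d = proxOne n x₀) ∨ (p = 2 ∧ d = proxTwo n) →
          ∀ ω, ((S ω).calls : ℝ) ≤ K * Real.log n ^ 2 *
            max ((n : ℝ) ^ (1 / 2 + (q⁻¹).toReal) * √(ℓ * pNorm p (x₀ - xs) ^ 2 / ε))
              ((n : ℝ) ^ (2 * (q⁻¹).toReal) * σ ^ 2 * pNorm p (x₀ - xs) ^ 2 / ε ^ 2))) ∧
    -- the two standard choices are prox-functions
    (∀ (n : ℕ), 8 ≤ n →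
      (∀ c : E n, IsProxFunction 1 (proxOne n c)) ∧ IsProxFunction 2 (proxTwo n)) := by
  refine ⟨⟨40, 1000, 1 / 5000, 40 * (1000 + 1) * 64, by simp, by simp, by simp, by positivity, ?_⟩,
    fun n hn => ⟨isProxFunction_proxOne (by omega), isProxFunction_proxTwo n⟩⟩
  rintro n hn p q hp hp2 hpq d hd Ξ _ P _ F L σ hP hL u hu ε hε x₀ _ _ _ rfl rfl rfl N m hN hm
    Δ _ hΔ hΔ₁ hΔ₂ rfl η hη hηΔ Ω _ Pr _ e ξ hlaw S hS
  have hn₃ : 3 ≤ n := by omega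
  have hρ := rho_pos hn₃ (two_le_of_inv_add_inv_eq_one hp2 hpq)
  have hΘ := bregman_nonneg hd x₀ u
  obtain rfl : S = _ := funext hS
  have hconv := hP.integrable_and_integral_run_sub_le hn₃ hp hp2 hpq hd hL hη hΔ hηΔ hu hε hN hm
    hΔ₁ hΔ₂ rfl hlaw
  have htn := smoothing_mul_sqrt_le (ν := n) (by positivity) hL hΘ hε.le hΔ.le (hΔ₁.trans
    (mul_le_of_le_one_left (by positivity) (by norm_num)))
  have htρ := smoothing_mul_rpow_le (ν := n) hρ.le hL hΘ hε.le hΔ.le (hΔ₂.trans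
    (mul_le_of_le_one_left (by positivity) (by norm_num)))
  have hNm := iterations_mul_batch_le (ν := n) (σ := σ) (by positivity) hρ hL hΘ hε
    (show 0 ≤ (40 : ℝ) by norm_num) (show 0 ≤ (1000 : ℝ) by norm_num)
  rw [← hN, ← hm, ← Nat.cast_mul] at hNm
  simp only [run_calls, true_and]
  refine ⟨hconv, (hN ▸ Nat.floor_le (by positivity)).trans (by gcongr; norm_num),
    hm ▸ Nat.one_le_ceil_iff.2 (by positivity),
    (hm ▸ natCeil_mul_max_one_le (by norm_num)).trans (by gcongr; norm_num),
    htn.trans (by gcongr; norm_num), htρ.trans (by gcongr; norm_num),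
    fun _ => hNm.trans (mul_le_mul_of_nonneg_right (by norm_num) (by positivity)),
    fun h _ => hNm.trans ?_⟩
  have hlog := one_le_pow₀ (one_lt_log hn₃).le (n := 2)
  grw [max_le_sq_mul_max (by positivity) hL hε (by linarith) (mul_rho_mul_bregman_le hn₃ hpq h)]
  exact le_of_eq (by ring)
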